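/- Let $\alpha,\beta,\gamma>-1$ be real. Put $$a_x=\tfrac{(x+\alpha+1)(x+\alpha+\beta+1)}{(2x+\alpha+\beta+1)(2x+\alpha+\beta+2)},\qquad c_x=\tfrac{x(x+\beta)}{(2x+\alpha+\beta)(2x+\alpha+\beta+1)},$$ $$b_x=\tfrac{(x+\alpha+1)(x+1)}{(2x+\alpha+\beta+1)(2x+\alpha+\beta+2)}+\tfrac{(x+\beta)(x+\alpha+\beta)}{(2x+\alpha+\beta)(2x+\alpha+\beta+1)},\qquad \delta_{x,y}=(x-y)(x+y+\alpha+\beta+1).$$ For integers $0\le k\le n$ let, with $g=\gamma+\tfrac12$, $$a_{n,k}=\tfrac12a_{n+g}\tfrac{\delta_{n+2\gamma+1,k}}{\delta_{n+g,k}},\quad c_{n,k}=\tfrac12c_{n+g}\tfrac{\delta_{n,k}}{\delta_{n+g,k}},\quad e_{n,k}=\tfrac12a_k\tfrac{\delta_{n+g,k+g}}{\delta_{n+g,k}},\quad d_{n,k}=\tfrac12c_k\tfrac{\delta_{n+g,k-g}}{\delta_{n+g,k}},$$ $$b_{n,k}=1-a_{n,k}-c_{n,k}-d_{n,k}-e_{n,k},$$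 $$a^{(1)}_{n,k}=2c_ka_{n+g}\tfrac{\delta_{n+g,k-g}\,\delta_{n+\gamma+1,k-\gamma-1}}{\delta_{n+\frac12(\gamma+\frac12),k-\frac12(\gamma+\frac12)}\,\delta_{n+\frac12(\gamma+\frac32),k-\frac12(\gamma+\frac32)}},\qquad a^{(2)}_{n,k}=(2b_k-1)a_{n+g}\tfrac{\delta_{n+2\gamma+1,k}}{\delta_{n+g,k}},$$ $$a^{(3)}_{n,k}=2a_ka_{n+g}\tfrac{\delta_{n+g,k+g}\,\delta_{n+\gamma+1,k+\gamma+1}}{\delta_{n+\frac12(\gamma+\frac12),k+\frac12(\gamma+\frac12)}\,\delta_{n+\frac12(\gamma+\frac32),k+\frac12(\gamma+\frac32)}},$$ $$b^{(1)}_{n,k}=(2b_{n+g}-1)c_k\tfrac{\delta_{n+g,k-g}}{\delta_{n+g,k}},\qquad b^{(3)}_{n,k}=(2b_{n+g}-1)a_k\tfrac{\delta_{n+g,k+g}}{\delta_{n+g,k}},$$ $$c^{(1)}_{n,k}=2c_kc_{n+g}\tfrac{\delta_{n,k}\,\delta_{n-\frac12,k-\frac12}}{\delta_{n+\frac12(\gamma-\frac12),k+\frac12(\gamma-\frac12)}\,\delta_{n+\frac12(\gamma+\frac12),k+\frac12(\gamma+\frac12)}},\qquad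 c^{(2)}_{n,k}=(2b_k-1)c_{n+g}\tfrac{\delta_{n,k}}{\delta_{n+g,k}},$$ $$c^{(3)}_{n,k}=2a_kc_{n+g}\tfrac{\delta_{n,k}\,\delta_{n-\frac12,k+\frac12}}{\delta_{n+\frac12(\gamma-\frac12),k-\frac12(\gamma-\frac12)}\,\delta_{n+\frac12(\gamma+\frac12),k-\frac12(\gamma+\frac12)}},$$ and let $b^{(2)}_{n,k}$ be $1$ minus the sum of the other eight coefficients $a^{(i)}_{n,k},b^{(i)}_{n,k},c^{(i)}_{n,k}$. The quotients are read as reduced rational functions: first a common factor $n-k$ is cancelled, then, for the given integers $n,k$, common factors in $\alpha,\beta,\gamma$ are cancelled (so the value at a removable singularity, for instance at $k=n$, $\gamma=-\tfrac12$, is the limit in the parameters). Coefficients that would lead outside the state space below are $0$. On the state space $\{(n,k):n\in\mathbb N_0,\ 0\le k\le n\}$ ($n$ is the level, $k$ the phase) let $J_1$ and $J_2$ be the matrices whose nonzero entries in row $(n,k)$ are as follows. For $J_1$: $a_{n,k}$ in column $(n+1,k)$; $d_{n,k},b_{n,k},e_{n,k}$ in columns $(n,k-1),(n,k),(n,k+1)$;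 $c_{n,k}$ in column $(n-1,k)$. For $J_2$: $a^{(1)}_{n,k},a^{(2)}_{n,k},a^{(3)}_{n,k}$ in columns $(n+1,k-1),(n+1,k),(n+1,k+1)$; $b^{(1)}_{n,k},b^{(2)}_{n,k},b^{(3)}_{n,k}$ in columns $(n,k-1),(n,k),(n,k+1)$; $c^{(1)}_{n,k},c^{(2)}_{n,k},c^{(3)}_{n,k}$ in columns $(n-1,k-1),(n-1,k),(n-1,k+1)$. (These are the Jacobi matrices of the bivariate Jacobi–Koornwinder polynomials on the swallow tail, normalized to be $1$ at $(1,1)$.) Let $P=(1-\tau)J_1+\tau J_2$ and $$C_{-1/2}=\frac{\alpha+\beta+2}{3\alpha-\beta+2},\qquad C_y=\frac{(\alpha+\beta+2y+1)(\alpha+\beta+2y+3)}{(\alpha+\beta+2y+1)(\alpha+\beta+2y+3)+2(\alpha^2-\beta^2)}\quad(y\neq-\tfrac12).$$ Then: 1. If $\alpha+\gamma+\tfrac32>0$ and $\beta+\gamma+\tfrac32>0$, all rows of $J_1$ and of $J_2$ sum to $1$. 2. (Region A.) If $\beta>\alpha$ and $\beta>-\alpha$, and, in case $\alpha<-\tfrac12$,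 also $\alpha+\gamma+\tfrac32>0$, then for every $0\le\tau\le1$ the matrix $P$ is stochastic (nonnegative entries, row sums $1$) and is the transition matrix of a discrete-time QBD process. 3. (Region B.) If $\alpha>\beta$, and, in case $\beta<-\tfrac12$, also $\beta+\gamma+\tfrac32>0$, then the same holds for every $0\le\tau\le C_{-1/2}$. 4. (Region C.) If $\beta>\alpha$ and $\beta<-\alpha$, and, in case $\alpha<-\tfrac12$, also $\alpha+\gamma+\tfrac32>0$, then the same holds for every $0\le\tau\le\min\{C_{1/2},C_{\gamma+1}\}$. Here "transition matrix of a discrete-time QBD process" means that $P$ is stochastic and block tridiagonal with respect to the levels, and that for every initial distribution there is a Markov chain $(Z_t)_{t\ge0}$ on the state space with one-step transition probabilities $P$. -/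

import Mathlib

/-! ## Discrete-time quasi-birth-and-death processes with levels `n` and phases `0, …, n` -/

namespace JacobiKoornwinder

/-- The state space `{(n, k) : n ∈ ℕ, 0 ≤ k ≤ n}`: `n` is the level and `k` the phase. -/
abbrev State : Type := Σ n : ℕ, Fin (n + 1)

/-- All row sums of a semi-infinite matrix are equal to one, i.e. `M e = e`. -/
def RowSumsOne (M : Matrix State State ℝ) : Prop :=
  ∀ s, HasSum (fun t => M s t) 1

/-- A stochastic matrix: nonnegative entries, and every row sums to one. -/
def IsStochastic (M : Matrix State State ℝ) : Prop :=
  (∀ s t, 0 ≤ M s t) ∧ RowSumsOne M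

/-- Block tridiagonal with respect to the levels. -/
def IsBlockTridiagonal (M : Matrix State State ℝ) : Prop :=
  ∀ s t : State, s.1 + 1 < t.1 ∨ t.1 + 1 < s.1 → M s t = 0

/-- `Z` is a discrete-time Markov chain with one-step transition probabilities `M` and initial
distribution `ν`: all its finite-dimensional path probabilities are the expected products. -/
def IsMarkovChain {Ω : Type} [MeasurableSpace Ω] (M : Matrix State State ℝ) (ν : PMF State)
    (μ : MeasureTheory.Measure Ω) (Z : ℕ → Ω → State) : Prop :=
  (∀ t s, MeasurableSet {ω | Z t ω = s}) ∧
  ∀ (t : ℕ) (s : ℕ → State),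
    μ {ω | ∀ i ≤ t, Z i ω = s i} =
      ν (s 0) * ∏ i ∈ Finset.range t, ENNReal.ofReal (M (s i) (s (i + 1)))

/-- `M` is the transition probability matrix of a discrete-time QBD process: it is stochastic and
block tridiagonal, and for every initial distribution there is a Markov chain governed by it. -/
def IsQBDTransitionMatrix (M : Matrix State State ℝ) : Prop :=
  IsStochastic M ∧ IsBlockTridiagonal M ∧
  ∀ ν : PMF State, ∃ (Ω : Type) (_ : MeasurableSpace Ω) (μ : MeasureTheory.Measure Ω)
    (Z : ℕ → Ω → State), MeasureTheory.IsProbabilityMeasure μ ∧ IsMarkovChain M ν μ Z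

/-! ## The notation `a_x`, `b_x`, `c_x`, `δ_{x,y}` -/

/-- `a_x`. -/
noncomputable def jacA (α β x : ℝ) : ℝ :=
  (x + α + 1) * (x + α + β + 1) / ((2 * x + α + β + 1) * (2 * x + α + β + 2))

/-- `b_x`. -/
noncomputable def jacB (α β x : ℝ) : ℝ :=
  (x + α + 1) * (x + 1) / ((2 * x + α + β + 1) * (2 * x + α + β + 2)) +
    (x + β) * (x + α + β) / ((2 * x + α + β) * (2 * x + α + β + 1))

/-- `c_x`. -/
noncomputable def jacC (α β x : ℝ) : ℝ :=
  x * (x + β) / ((2 * x + α + β) * (2 * x + α + β + 1))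

/-- `δ_{x,y}`. -/
noncomputable def del (α β x y : ℝ) : ℝ := (x - y) * (x + y + α + β + 1)

/-- `a_k` for an integer `k ≥ 0`; the common factor `α + β + 1` is cancelled at `k = 0`. -/
noncomputable def aI (α β : ℝ) (k : ℕ) : ℝ :=
  if k = 0 then (α + 1) / (α + β + 2) else jacA α β k

/-- `b_k` for an integer `k ≥ 0`; the common factors `α + β` and `α + β + 1` are cancelled
at `k = 0`. -/
noncomputable def bI (α β : ℝ) (k : ℕ) : ℝ :=
  if k = 0 then (β + 1) / (α + β + 2) else jacB α β k

/-- `c_k` for an integer `k ≥ 0`; it vanishes at `k = 0`. -/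
noncomputable def cI (α β : ℝ) (k : ℕ) : ℝ := jacC α β k

/-! ## The coefficients

The coefficients are rational functions given by quotients of products of `a`, `b`, `c` and `δ`.
Some of these quotients take the form `0 / 0` although the rational function itself is regular:
always at `k = n` in `a_{n,n}^{(3)}` and `c_{n,n}^{(1)}`, where `n - k` cancels; at `k = n` when
`γ = -1/2`; and at `n = 0` when `2γ + α + β + 2 = 0` or `γ + α + β + 3/2 = 0`.  Common factors are
therefore cancelled in the definitions.  The lemmas in the next section show that wherever the
denominators do not vanish the result is the uncancelled quotient. All coefficients are
automatically zero outside their index range (`k = 0` for those leading to phase `k - 1`, and so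
on), because of a factor `c_0 = 0`, `n - k = 0` or `n - k - 1 = 0` in the numerator. -/

/-- `(n - k + 2γ + 1) / (n - k + γ + 1/2)`, with the common factor cancelled at `k = n`. -/
noncomputable def ratio (γ : ℝ) (n k : ℕ) : ℝ :=
  if k = n then 2 else ((n : ℝ) - k + 2 * γ + 1) / ((n : ℝ) - k + γ + 1 / 2)

/-- `a_{n+γ+1/2} (n + k + α + β + 2γ + 2) / (n + k + α + β + γ + 3/2)`, with the common factors
cancelled at `n = 0` (which is only used with `k = 0`). -/
noncomputable def upFactor (α β γ : ℝ) (n k : ℕ) : ℝ :=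
  if n = 0 then (α + γ + 3 / 2) / (α + β + 2 * γ + 3)
  else jacA α β (n + γ + 1 / 2) * ((n + k + α + β + 2 * γ + 2) / (n + k + α + β + γ + 3 / 2))

/-- `a_{n,k}`. -/
noncomputable def a (α β γ : ℝ) (n k : ℕ) : ℝ :=
  1 / 2 * upFactor α β γ n k * ratio γ n k

/-- `c_{n,k}`. -/
noncomputable def c (α β γ : ℝ) (n k : ℕ) : ℝ :=
  1 / 2 * jacC α β (n + γ + 1 / 2) * (del α β n k / del α β (n + γ + 1 / 2) k)

/-- `e_{n,k}`. -/
noncomputable def e (α β γ : ℝ) (n k : ℕ) : ℝ :=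
  1 / 2 * aI α β k *
    (del α β (n + γ + 1 / 2) (k + γ + 1 / 2) / del α β (n + γ + 1 / 2) k)

/-- `d_{n,k}`. -/
noncomputable def d (α β γ : ℝ) (n k : ℕ) : ℝ :=
  1 / 2 * cI α β k *
    (ratio γ n k * ((n + k + α + β + 1) / (n + k + α + β + γ + 3 / 2)))

/-- `b_{n,k}`. -/
noncomputable def b (α β γ : ℝ) (n k : ℕ) : ℝ :=
  1 - a α β γ n k - c α β γ n k - d α β γ n k - e α β γ n k

/-- `a_{n,k}^{(1)}`. -/
noncomputable def a1 (α β γ : ℝ) (n k : ℕ) : ℝ :=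
  2 * cI α β k * jacA α β (n + γ + 1 / 2) *
    (ratio γ n k * (((n : ℝ) - k + 2 * γ + 2) / ((n : ℝ) - k + γ + 3 / 2)))

/-- `a_{n,k}^{(2)}`. -/
noncomputable def a2 (α β γ : ℝ) (n k : ℕ) : ℝ :=
  (2 * bI α β k - 1) * (upFactor α β γ n k * ratio γ n k)

/-- `a_{n,k}^{(3)}`. -/
noncomputable def a3 (α β γ : ℝ) (n k : ℕ) : ℝ :=
  2 * aI α β k *
    (upFactor α β γ n k * ((n + k + α + β + 2 * γ + 3) / (n + k + α + β + γ + 5 / 2)))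

/-- `b_{n,k}^{(1)}`. -/
noncomputable def b1 (α β γ : ℝ) (n k : ℕ) : ℝ :=
  (2 * jacB α β (n + γ + 1 / 2) - 1) * cI α β k *
    (ratio γ n k * ((n + k + α + β + 1) / (n + k + α + β + γ + 3 / 2)))

/-- `b_{n,k}^{(3)}`. -/
noncomputable def b3 (α β γ : ℝ) (n k : ℕ) : ℝ :=
  (2 * jacB α β (n + γ + 1 / 2) - 1) * aI α β k *
    (del α β (n + γ + 1 / 2) (k + γ + 1 / 2) / del α β (n + γ + 1 / 2) k)

/-- `c_{n,k}^{(1)}`. -/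
noncomputable def c1 (α β γ : ℝ) (n k : ℕ) : ℝ :=
  2 * cI α β k * jacC α β (n + γ + 1 / 2) *
    ((n + k + α + β + 1) * (n + k + α + β) /
      ((n + k + α + β + γ + 1 / 2) * (n + k + α + β + γ + 3 / 2)))

/-- `c_{n,k}^{(2)}`. -/
noncomputable def c2 (α β γ : ℝ) (n k : ℕ) : ℝ :=
  (2 * bI α β k - 1) * jacC α β (n + γ + 1 / 2) *
    (del α β n k / del α β (n + γ + 1 / 2) k)

/-- `c_{n,k}^{(3)}`. -/
noncomputable def c3 (α β γ : ℝ) (n k : ℕ) : ℝ :=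
  2 * aI α β k * jacC α β (n + γ + 1 / 2) *
    (del α β n k * del α β (n - 1 / 2) (k + 1 / 2) /
      (del α β (n + 1 / 2 * (γ - 1 / 2)) (k - 1 / 2 * (γ - 1 / 2)) *
        del α β (n + 1 / 2 * (γ + 1 / 2)) (k - 1 / 2 * (γ + 1 / 2))))

/-- `b_{n,k}^{(2)}`. -/
noncomputable def b2 (α β γ : ℝ) (n k : ℕ) : ℝ :=
  1 - b1 α β γ n k - b3 α β γ n k - a1 α β γ n k - a2 α β γ n k - a3 α β γ n k
    - c1 α β γ n k - c2 α β γ n k - c3 α β γ n k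

/-! ## Agreement with the uncancelled quotients -/

theorem aI_eq (α β : ℝ) (k : ℕ) (h1 : 2 * (k : ℝ) + α + β + 1 ≠ 0) :
    aI α β k = jacA α β k := by
  unfold aI jacA
  split_ifs with h
  · subst h
    simp only [Nat.cast_zero, mul_zero, zero_add] at *
    rw [mul_comm (α + β + 1), mul_div_mul_right _ _ h1]
  · rfl

theorem bI_eq (α β : ℝ) (k : ℕ) (h0 : 2 * (k : ℝ) + α + β ≠ 0)
    (h1 : 2 * (k : ℝ) + α + β + 1 ≠ 0) (h2 : 2 * (k : ℝ) + α + β + 2 ≠ 0) :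
    bI α β k = jacB α β k := by
  unfold bI jacB
  split_ifs with h
  · subst h
    simp only [Nat.cast_zero, mul_zero, zero_add] at *
    field_simp
    ring
  · rfl

theorem ratio_eq (γ : ℝ) (n k : ℕ) (h : (n : ℝ) - k + γ + 1 / 2 ≠ 0) :
    ratio γ n k = ((n : ℝ) - k + 2 * γ + 1) / ((n : ℝ) - k + γ + 1 / 2) := by
  unfold ratio
  split_ifs with hk
  · subst hk
    rw [eq_div_iff h]
    ring
  · rfl

theorem upFactor_eq (α β γ : ℝ) (n k : ℕ) (hk : k ≤ n)
    (h1 : 2 * (n + γ + 1 / 2) + α + β + 1 ≠ 0)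
    (h3 : (n : ℝ) + k + α + β + γ + 3 / 2 ≠ 0) :
    upFactor α β γ n k = jacA α β (n + γ + 1 / 2) *
      ((n + k + α + β + 2 * γ + 2) / (n + k + α + β + γ + 3 / 2)) := by
  unfold upFactor
  split_ifs with hn
  · subst hn
    obtain rfl : k = 0 := by omega
    unfold jacA
    simp only [Nat.cast_zero, zero_add, add_zero] at *
    rw [div_mul_div_comm]
    have e1 : (γ + 1 / 2 + α + 1) * (γ + 1 / 2 + α + β + 1) * (α + β + 2 * γ + 2)
        = (α + γ + 3 / 2) * ((2 * (γ + 1 / 2) + α + β + 1) * (α + β + γ + 3 / 2)) := by ring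
    have e2 : (2 * (γ + 1 / 2) + α + β + 1) * (2 * (γ + 1 / 2) + α + β + 2) *
        (α + β + γ + 3 / 2)
        = (α + β + 2 * γ + 3) * ((2 * (γ + 1 / 2) + α + β + 1) * (α + β + γ + 3 / 2)) := by
      ring
    rw [e1, e2, mul_div_mul_right _ _ (mul_ne_zero h1 h3)]
  · rfl

theorem a_eq (α β γ : ℝ) (n k : ℕ) (hk : k ≤ n)
    (h1 : 2 * (n + γ + 1 / 2) + α + β + 1 ≠ 0) (hδ : del α β (n + γ + 1 / 2) k ≠ 0) :
    a α β γ n k = 1 / 2 * jacA α β (n + γ + 1 / 2) *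
      (del α β (n + 2 * γ + 1) k / del α β (n + γ + 1 / 2) k) := by
  unfold del at *
  obtain ⟨hl, hr⟩ := mul_ne_zero_iff.1 hδ
  have hl' : (n : ℝ) - k + γ + 1 / 2 ≠ 0 := fun h => hl (by linarith)
  have hr' : (n : ℝ) + k + α + β + γ + 3 / 2 ≠ 0 := fun h => hr (by linarith)
  rw [a, upFactor_eq α β γ n k hk h1 hr', ratio_eq γ n k hl', mul_assoc, mul_assoc, mul_assoc,
    div_mul_div_comm]
  congr 3 <;> ring

theorem a2_eq (α β γ : ℝ) (n k : ℕ) (hk : k ≤ n)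
    (h1 : 2 * (n + γ + 1 / 2) + α + β + 1 ≠ 0) (hδ : del α β (n + γ + 1 / 2) k ≠ 0) :
    a2 α β γ n k = (2 * bI α β k - 1) * jacA α β (n + γ + 1 / 2) *
      (del α β (n + 2 * γ + 1) k / del α β (n + γ + 1 / 2) k) := by
  have h := a_eq α β γ n k hk h1 hδ
  unfold a at h
  unfold a2
  rw [show upFactor α β γ n k * ratio γ n k
      = 2 * (1 / 2 * upFactor α β γ n k * ratio γ n k) by ring, h]
  ring

theorem d_factor_eq (α β γ : ℝ) (n k : ℕ) (hδ : del α β (n + γ + 1 / 2) k ≠ 0) :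
    ratio γ n k * ((n + k + α + β + 1) / (n + k + α + β + γ + 3 / 2)) =
      del α β (n + γ + 1 / 2) (k - γ - 1 / 2) / del α β (n + γ + 1 / 2) k := by
  unfold del at *
  obtain ⟨hl, hr⟩ := mul_ne_zero_iff.1 hδ
  have hl' : (n : ℝ) - k + γ + 1 / 2 ≠ 0 := fun h => hl (by linarith)
  rw [ratio_eq γ n k hl', div_mul_div_comm]
  congr 1 <;> ring

theorem d_eq (α β γ : ℝ) (n k : ℕ) (hδ : del α β (n + γ + 1 / 2) k ≠ 0) :
    d α β γ n k = 1 / 2 * cI α β k *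
      (del α β (n + γ + 1 / 2) (k - γ - 1 / 2) / del α β (n + γ + 1 / 2) k) := by
  rw [d, d_factor_eq α β γ n k hδ]

theorem b1_eq (α β γ : ℝ) (n k : ℕ) (hδ : del α β (n + γ + 1 / 2) k ≠ 0) :
    b1 α β γ n k = (2 * jacB α β (n + γ + 1 / 2) - 1) * cI α β k *
      (del α β (n + γ + 1 / 2) (k - γ - 1 / 2) / del α β (n + γ + 1 / 2) k) := by
  rw [b1, d_factor_eq α β γ n k hδ]

theorem a1_eq (α β γ : ℝ) (n k : ℕ)
    (hδ : del α β (n + 1 / 2 * (γ + 1 / 2)) (k - 1 / 2 * (γ + 1 / 2)) *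
      del α β (n + 1 / 2 * (γ + 3 / 2)) (k - 1 / 2 * (γ + 3 / 2)) ≠ 0) :
    a1 α β γ n k = 2 * cI α β k * jacA α β (n + γ + 1 / 2) *
      (del α β (n + γ + 1 / 2) (k - γ - 1 / 2) * del α β (n + γ + 1) (k - γ - 1) /
        (del α β (n + 1 / 2 * (γ + 1 / 2)) (k - 1 / 2 * (γ + 1 / 2)) *
          del α β (n + 1 / 2 * (γ + 3 / 2)) (k - 1 / 2 * (γ + 3 / 2)))) := by
  unfold del at *
  obtain ⟨hl, hr⟩ := mul_ne_zero_iff.1 hδ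
  obtain ⟨hl1, hl2⟩ := mul_ne_zero_iff.1 hl
  have h1 : (n : ℝ) - k + γ + 1 / 2 ≠ 0 := fun h => hl1 (by linarith)
  have h2 : (n : ℝ) + k + α + β + 1 ≠ 0 := fun h => hl2 (by linarith)
  rw [a1, ratio_eq γ n k h1, div_mul_div_comm]
  congr 1
  refine (mul_div_mul_right _ _ (mul_ne_zero h2 h2)).symm.trans ?_
  congr 1 <;> ring

theorem a3_eq (α β γ : ℝ) (n k : ℕ) (hk : k ≤ n)
    (h1 : 2 * (n + γ + 1 / 2) + α + β + 1 ≠ 0)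
    (hδ : del α β (n + 1 / 2 * (γ + 1 / 2)) (k + 1 / 2 * (γ + 1 / 2)) *
      del α β (n + 1 / 2 * (γ + 3 / 2)) (k + 1 / 2 * (γ + 3 / 2)) ≠ 0) :
    a3 α β γ n k = 2 * aI α β k * jacA α β (n + γ + 1 / 2) *
      (del α β (n + γ + 1 / 2) (k + γ + 1 / 2) * del α β (n + γ + 1) (k + γ + 1) /
        (del α β (n + 1 / 2 * (γ + 1 / 2)) (k + 1 / 2 * (γ + 1 / 2)) *
          del α β (n + 1 / 2 * (γ + 3 / 2)) (k + 1 / 2 * (γ + 3 / 2)))) := by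
  unfold del at *
  obtain ⟨hl, hr⟩ := mul_ne_zero_iff.1 hδ
  obtain ⟨hl1, hl2⟩ := mul_ne_zero_iff.1 hl
  have h2 : (n : ℝ) - k ≠ 0 := fun h => hl1 (by linarith)
  have h3 : (n : ℝ) + k + α + β + γ + 3 / 2 ≠ 0 := fun h => hl2 (by linarith)
  rw [a3, upFactor_eq α β γ n k hk h1 h3, mul_assoc (jacA _ _ _), div_mul_div_comm, ← mul_assoc]
  congr 1
  refine (mul_div_mul_right _ _ (mul_ne_zero h2 h2)).symm.trans ?_
  congr 1 <;> ring

theorem c1_eq (α β γ : ℝ) (n k : ℕ) (hk : (n : ℝ) - k ≠ 0) :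
    c1 α β γ n k = 2 * cI α β k * jacC α β (n + γ + 1 / 2) *
      (del α β n k * del α β (n - 1 / 2) (k - 1 / 2) /
        (del α β (n + 1 / 2 * (γ - 1 / 2)) (k + 1 / 2 * (γ - 1 / 2)) *
          del α β (n + 1 / 2 * (γ + 1 / 2)) (k + 1 / 2 * (γ + 1 / 2)))) := by
  unfold del
  rw [c1]
  congr 1
  refine (mul_div_mul_right _ _ (mul_ne_zero hk hk)).symm.trans ?_
  congr 1 <;> ring

/-! ## The Jacobi matrices -/

/-- A tridiagonal (not necessarily square) block: row `k` has the entries `l k`, `m k`, `u k` in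
the columns `k - 1`, `k`, `k + 1`. -/
def tridiag (l m u : ℕ → ℝ) (k j : ℕ) : ℝ :=
  if j + 1 = k then l k else if j = k then m k else if j = k + 1 then u k else 0

/-- The block tridiagonal matrix whose row of blocks of level `n` is `C n`, `B n`, `A n`. The
sizes of these blocks are `(n + 1) × n`, `(n + 1) × (n + 1)` and `(n + 1) × (n + 2)`. -/
def blockTridiag (A B C : ℕ → ℕ → ℕ → ℝ) : Matrix State State ℝ := fun s t =>
  if t.1 = s.1 + 1 then A s.1 s.2 t.2
  else if t.1 = s.1 then B s.1 s.2 t.2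
  else if t.1 + 1 = s.1 then C s.1 s.2 t.2
  else 0

/-- The Jacobi matrix `J₁`. -/
noncomputable def J1 (α β γ : ℝ) : Matrix State State ℝ :=
  blockTridiag
    (fun n => tridiag 0 (a α β γ n) 0)
    (fun n => tridiag (d α β γ n) (b α β γ n) (e α β γ n))
    (fun n => tridiag 0 (c α β γ n) 0)

/-- The Jacobi matrix `J₂`. -/
noncomputable def J2 (α β γ : ℝ) : Matrix State State ℝ :=
  blockTridiag
    (fun n => tridiag (a1 α β γ n) (a2 α β γ n) (a3 α β γ n))
    (fun n => tridiag (b1 α β γ n) (b2 α β γ n) (b3 α β γ n))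
    (fun n => tridiag (c1 α β γ n) (c2 α β γ n) (c3 α β γ n))

/-- `P = (1 - τ) J₁ + τ J₂`. -/
noncomputable def P (α β γ τ : ℝ) : Matrix State State ℝ :=
  (1 - τ) • J1 α β γ + τ • J2 α β γ

/-- The constant `C_y`. -/
noncomputable def Cst (α β y : ℝ) : ℝ :=
  (α + β + 2 * y + 1) * (α + β + 2 * y + 3) /
    ((α + β + 2 * y + 1) * (α + β + 2 * y + 3) + 2 * (α ^ 2 - β ^ 2))

/-- The constant `C_{-1/2}`, in which the common factor `α + β` is cancelled. -/
noncomputable def CstNegHalf (α β : ℝ) : ℝ := (α + β + 2) / (3 * α - β + 2)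

end JacobiKoornwinder

/-! The row sums hold because each diagonal coefficient is defined as the complement of the others,
once the entries that would leave the state space are seen to vanish. The content lies in
nonnegativity.

The single shifts of `J2` are multiples of entries of `J1` (`a2_eq_mul`, `c2_eq_mul`, `b1_eq_mul`,
`b3_eq_mul`). In `P` these positions therefore carry a nonnegative entry of `J1` times a weight `1 -
τ + 2τ(2b_x - 1)`, with `x = k` or `x = n + γ + 1/2`. By `two_mul_jacB_sub_one` the sign of `2b_x -
1` is that of `β² - α²` when its denominator is positive, which turns the weight conditions into the
bounds on `τ` in the three regions. The double shifts are products of nonnegative factors.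

The diagonals need another expression. Interchanging `α` and `β` turns the complement `b` into the
sum of the four other coefficients with swapped parameters (`Regular.b_eq`), and `b2` is likewise a
sum of explicit nonnegative terms (`Regular.b2_eq`). Both are rational identities in `X = n + γ +
1/2 + ρ` and `Y = k + ρ`, where `ρ = (α + β + 1)/2`: lowering an index is the reflection `X ↦ -X` or
`Y ↦ -Y` of raising it. They are proved where no denominator vanishes, and nonnegativity passes to
all admissible parameters by continuity (`Admissible.nonneg_of_regular`).

Finally, a stochastic matrix on this countable space has a Markov chain by the Ionescu-Tulcea
theorem. -/

namespace JacobiKoornwinder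

/-! ## Markov chains with a given stochastic matrix -/

section MarkovChain

open MeasureTheory ProbabilityTheory Preorder

/-- A row of a stochastic matrix as a probability mass function. -/
noncomputable def rowPMF {M : Matrix State State ℝ} (hM : IsStochastic M) (s : State) :
    PMF State :=
  ⟨fun t => ENNReal.ofReal (M s t), by
    have h := (hM.2 s).tsum_eq
    have hs := ENNReal.ofReal_tsum_of_nonneg (hM.1 s) (hM.2 s).summable
    rw [h, ENNReal.ofReal_one] at hs
    rw [hs]
    exact ENNReal.summable.hasSum⟩

/-- A stochastic matrix has a Markov chain for every initial distribution. -/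
theorem exists_isMarkovChain {M : Matrix State State ℝ} (hM : IsStochastic M) (ν : PMF State) :
    ∃ (Ω : Type) (_ : MeasurableSpace Ω) (μ : Measure Ω) (Z : ℕ → Ω → State),
      IsProbabilityMeasure μ ∧ IsMarkovChain M ν μ Z := by
  let : MeasurableSpace State := ⊤
  have : DiscreteMeasurableSpace State := ⟨fun _ => trivial⟩
  -- The Markov property is built in: the kernel sees a history only through its last coordinate.
  let κ : (n : ℕ) → Kernel ((i : Finset.Iic n) → State) State := fun n =>
    Kernel.ofFunOfCountable fun x => (rowPMF hM (x ⟨n, Finset.mem_Iic.2 le_rfl⟩)).toMeasure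
  have : ∀ n, IsMarkovKernel (κ n) := fun n =>
    ⟨fun x => PMF.toMeasure.isProbabilityMeasure
      (rowPMF hM (x ⟨n, Finset.mem_Iic.2 le_rfl⟩))⟩
  let μ : Measure (ℕ → State) := Kernel.trajMeasure (X := fun _ => State) ν.toMeasure κ
  -- A path event is a singleton of the finite product, pulled back along restriction to times up to
  -- `t`.
  have hcyl : ∀ (t : ℕ) (s : ℕ → State), {ω : ℕ → State | ∀ i ≤ t, ω i = s i} =
      frestrictLe (π := fun _ => State) t ⁻¹' {fun i : Finset.Iic t => s i} := by
    intro t s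
    ext ω
    simp only [Set.mem_ofPred_eq, Set.mem_preimage, Set.mem_singleton_iff, funext_iff,
      Subtype.forall, Finset.mem_Iic, frestrictLe_apply]
  refine ⟨ℕ → State, inferInstance, μ, fun i ω => ω i, inferInstance, ?_, ?_⟩
  · intro t s
    exact measurable_pi_apply (X := fun _ : ℕ => State) t (MeasurableSet.singleton s)
  intro t s
  induction t with
  | zero =>
    -- The time-zero marginal is `ν`, up to identifying a one-factor product with its factor.
    have h0 : Measure.map (frestrictLe (π := fun _ => State) 0) μ =
        ν.toMeasure.map
          (MeasurableEquiv.piUnique (fun _ : Finset.Iic 0 => State)).symm := by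
      simp only [μ]
      rw [Kernel.trajMeasure, Measure.map_comp _ _ (by fun_prop), Kernel.traj_map_frestrictLe,
        Kernel.partialTraj_self, Measure.id_comp]
    rw [hcyl, ← Measure.map_apply (by fun_prop) (MeasurableSet.singleton _), h0,
      Measure.map_apply (by fun_prop) (MeasurableSet.singleton _)]
    have : (MeasurableEquiv.piUnique (fun _ : Finset.Iic 0 => State)).symm ⁻¹'
        {fun i : Finset.Iic 0 => s i} = {s 0} := by
      ext x
      simp only [Set.mem_preimage, Set.mem_singleton_iff]
      constructor
      · intro h
        exact congrFun h ⟨0, Finset.mem_Iic.2 le_rfl⟩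
      · rintro rfl
        funext i
        obtain ⟨i, hi⟩ := i
        obtain rfl : i = 0 := by simpa using hi
        rfl
    rw [this, PMF.toMeasure_apply_singleton _ _ (MeasurableSet.singleton _)]
    simp
  | succ t ih =>
    -- The event is split into a history and one further step, so that the composition-product of
    -- history law and kernel applies; on singletons its integral is a product.
    have hsplit : {ω : ℕ → State | ∀ i ≤ t + 1, ω i = s i} =
        (fun ω : ℕ → State => (frestrictLe (π := fun _ => State) t ω, ω (t + 1))) ⁻¹'
          ({fun i : Finset.Iic t => s i} ×ˢ {s (t + 1)}) := by
      rw [Set.mk_preimage_prod, ← hcyl]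
      ext ω
      simp only [Set.mem_ofPred_eq, Set.mem_inter_iff, Set.mem_preimage, Set.mem_singleton_iff]
      constructor
      · exact fun h => ⟨fun i hi => h i (by omega), h _ le_rfl⟩
      · rintro ⟨h1, h2⟩ i hi
        rcases Nat.le_succ_iff.1 hi with h | rfl
        · exact h1 i h
        · exact h2
    have hm : MeasurableSet
        (({fun i : Finset.Iic t => s i} : Set (Finset.Iic t → State)) ×ˢ ({s (t + 1)} : Set State)) :=
      (MeasurableSet.singleton _).prod (MeasurableSet.singleton _)
    rw [hcyl, ← Measure.map_apply (by fun_prop) (MeasurableSet.singleton _)] at ih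
    rw [hsplit, ← Measure.map_apply (by fun_prop) hm,
      ← Kernel.map_frestrictLe_trajMeasure_compProd_eq_map_trajMeasure,
      Measure.compProd_apply_prod (MeasurableSet.singleton _) (MeasurableSet.singleton _),
      lintegral_singleton, mul_comm, ih, Finset.prod_range_succ, mul_assoc]
    congr 2
    change (rowPMF hM (s t)).toMeasure {s (t + 1)} = _
    rw [PMF.toMeasure_apply_singleton _ _ (MeasurableSet.singleton _)]
    rfl

end MarkovChain

/-! ## Rational function identities -/

/-- The common shape of `a_x`, `c_x`, with `X = x + ρ` and `ρ = (α + β + 1) / 2`. -/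
noncomputable def jacShift (p ρ X : ℝ) : ℝ := (X + p) * (X + ρ) / (2 * X * (2 * X + 1))

theorem jacShift_neg (p ρ X : ℝ) :
    jacShift p ρ (-X) = (X - p) * (X - ρ) / (2 * X * (2 * X - 1)) := by
  unfold jacShift
  congr 1 <;> ring

/-- The double shifts of `J₂` and two of the diagonal contributions combine to an expression in
which the factor `X + Y + 1` cancels. -/
theorem double_shift_add (X Y p ρ g : ℝ) (hX : X ≠ 0) (hX1 : 2 * X + 1 ≠ 0) (hY : Y ≠ 0)
    (hY1 : 2 * Y + 1 ≠ 0) (h0 : X + Y ≠ 0) (h1 : X + Y + 1 ≠ 0) :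
    2 * jacShift p ρ X * jacShift p ρ Y *
        ((X + Y + g) * (X + Y + g + 1) / ((X + Y) * (X + Y + 1))) +
      (jacShift p ρ X * jacShift p ρ Y + jacShift (1 - p) ρ X * jacShift (1 - p) ρ Y) *
        ((X + Y + g) * (X + Y + 1 - g) / ((X + Y) * (X + Y + 1))) =
    (X + ρ) * (Y + ρ) / (2 * X * (2 * X + 1) * (2 * Y * (2 * Y + 1))) *
      ((X + Y + g) / (X + Y)) *
      (4 * (X + p) * (Y + p) - (2 * p - 1) * (X + Y + 1 - g)) := by
  unfold jacShift
  -- The linear denominators stay atoms while fractions are cleared; their definitions return only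
  -- for the final polynomial identity.
  generalize hU : 2 * X + 1 = U at *
  generalize hV : 2 * Y + 1 = V at *
  generalize hS : X + Y = S at *
  generalize hT : S + 1 = T at *
  field_simp
  subst hU hV hT hS
  ring

/-- The four lines are raising and lowering `n`, then raising and lowering `k`; they arise from the
first by `X ↦ -X` and by exchanging `X` and `Y`. Swapping `α` and `β` is `p ↦ 1 - p`, so half of
this identity says that the off-diagonal coefficients of `J1` for both parameter orders sum to one.
-/
theorem single_shift_sum (X Y p ρ g : ℝ) (hX : X ≠ 0) (hX1 : 2 * X + 1 ≠ 0)
    (hX2 : 2 * X - 1 ≠ 0) (hY : Y ≠ 0) (hY1 : 2 * Y + 1 ≠ 0) (hY2 : 2 * Y - 1 ≠ 0)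
    (h0 : X + Y ≠ 0) (h1 : X - Y ≠ 0) :
    (jacShift p ρ X + jacShift (1 - p) ρ X) *
        ((X - Y + g) * (X + Y + g) / ((X - Y) * (X + Y))) +
      (jacShift p ρ (-X) + jacShift (1 - p) ρ (-X)) *
        ((X - Y - g) * (X + Y - g) / ((X - Y) * (X + Y))) +
      (jacShift p ρ Y + jacShift (1 - p) ρ Y) *
        ((X - Y - g) * (X + Y + g) / ((X - Y) * (X + Y))) +
      (jacShift p ρ (-Y) + jacShift (1 - p) ρ (-Y)) *
        ((X - Y + g) * (X + Y - g) / ((X - Y) * (X + Y))) = 2 := by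
  simp only [jacShift_neg]
  unfold jacShift
  generalize hU : 2 * X + 1 = U at *
  generalize hU' : 2 * X - 1 = U' at *
  generalize hV : 2 * Y + 1 = V at *
  generalize hV' : 2 * Y - 1 = V' at *
  generalize hS : X + Y = S at *
  generalize hD : X - Y = D at *
  field_simp
  subst hU hU' hV hV' hS hD
  ring

/-- This is what remains of `double_shift_sum` after `double_shift_add` has removed the poles at `X
± Y = ±1`; the smaller common denominator keeps the polynomial identity tractable. -/
theorem cancelled_shift_sum (X Y p ρ g : ℝ) (hX : X ≠ 0) (hX1 : 2 * X + 1 ≠ 0)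
    (hX2 : 2 * X - 1 ≠ 0) (hY : Y ≠ 0) (hY1 : 2 * Y + 1 ≠ 0) (hY2 : 2 * Y - 1 ≠ 0)
    (h0 : X + Y ≠ 0) (h1 : X - Y ≠ 0) :
    (X + ρ) * (Y + ρ) / (2 * X * (2 * X + 1) * (2 * Y * (2 * Y + 1))) * ((X + Y + g) / (X + Y)) *
      (4 * (X + p) * (Y + p) - (2 * p - 1) * (X + Y + 1 - g)) +
    (X - ρ) * (Y - ρ) / (2 * X * (2 * X - 1) * (2 * Y * (2 * Y - 1))) * ((X + Y - g) / (X + Y)) *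
      (4 * (X - p) * (Y - p) + (2 * p - 1) * (X + Y - 1 + g)) +
    (X + ρ) * (Y - ρ) / (2 * X * (2 * X + 1) * (2 * Y * (2 * Y - 1))) * ((X - Y + g) / (X - Y)) *
      (4 * (X + p) * (Y - p) + (2 * p - 1) * (X - Y + 1 - g)) +
    (X - ρ) * (Y + ρ) / (2 * X * (2 * X - 1) * (2 * Y * (2 * Y + 1))) * ((X - Y - g) / (X - Y)) *
      (4 * (X - p) * (Y + p) - (2 * p - 1) * (X - Y - 1 + g)) +
    (2 * p - 1) * (1 - 2 * ρ) / ((2 * Y - 1) * (2 * Y + 1)) * (jacShift p ρ X *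
        ((X - Y + g) * (X + Y + g) / ((X - Y) * (X + Y))) +
      jacShift p ρ (-X) *
        ((X - Y - g) * (X + Y - g) / ((X - Y) * (X + Y)))) +
    (2 * p - 1) * (1 - 2 * ρ) / ((2 * X - 1) * (2 * X + 1)) * (jacShift p ρ Y *
        ((X - Y - g) * (X + Y + g) / ((X - Y) * (X + Y))) +
      jacShift p ρ (-Y) *
        ((X - Y + g) * (X + Y - g) / ((X - Y) * (X + Y)))) = 1 := by
  simp only [jacShift_neg]
  unfold jacShift
  generalize hU : 2 * X + 1 = U at *
  generalize hU' : 2 * X - 1 = U' at *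
  generalize hV : 2 * Y + 1 = V at *
  generalize hV' : 2 * Y - 1 = V' at *
  generalize hS : X + Y = S at *
  generalize hD : X - Y = D at *
  field_simp
  subst hU hU' hV hV' hS hD
  ring

/-- The eight single and double shifts of `J₂` and its two families of diagonal contributions
sum to one. -/
theorem double_shift_sum (X Y p ρ g : ℝ) (hX : X ≠ 0) (hX1 : 2 * X + 1 ≠ 0)
    (hX2 : 2 * X - 1 ≠ 0) (hY : Y ≠ 0) (hY1 : 2 * Y + 1 ≠ 0) (hY2 : 2 * Y - 1 ≠ 0)
    (h0 : X + Y ≠ 0) (h1 : X + Y + 1 ≠ 0) (h2 : X + Y - 1 ≠ 0)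
    (h0' : X - Y ≠ 0) (h1' : X - Y + 1 ≠ 0) (h2' : X - Y - 1 ≠ 0) :
    2 * jacShift p ρ X * jacShift p ρ Y *
        ((X + Y + g) * (X + Y + g + 1) / ((X + Y) * (X + Y + 1))) +
      (jacShift p ρ X * jacShift p ρ Y + jacShift (1 - p) ρ X * jacShift (1 - p) ρ Y) *
        ((X + Y + g) * (X + Y + 1 - g) / ((X + Y) * (X + Y + 1))) +
    2 * jacShift p ρ (-X) * jacShift p ρ (-Y) *
        ((X + Y - g) * (X + Y - g - 1) / ((X + Y) * (X + Y - 1))) +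
      (jacShift p ρ (-X) * jacShift p ρ (-Y) +
          jacShift (1 - p) ρ (-X) * jacShift (1 - p) ρ (-Y)) *
        ((X + Y - g) * (X + Y - 1 + g) / ((X + Y) * (X + Y - 1))) +
    2 * jacShift p ρ X * jacShift p ρ (-Y) *
        ((X - Y + g) * (X - Y + g + 1) / ((X - Y) * (X - Y + 1))) +
      (jacShift p ρ X * jacShift p ρ (-Y) + jacShift (1 - p) ρ X * jacShift (1 - p) ρ (-Y)) *
        ((X - Y + g) * (X - Y + 1 - g) / ((X - Y) * (X - Y + 1))) +
    2 * jacShift p ρ (-X) * jacShift p ρ Y *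
        ((X - Y - g) * (X - Y - g - 1) / ((X - Y) * (X - Y - 1))) +
      (jacShift p ρ (-X) * jacShift p ρ Y + jacShift (1 - p) ρ (-X) * jacShift (1 - p) ρ Y) *
        ((X - Y - g) * (X - Y - 1 + g) / ((X - Y) * (X - Y - 1))) +
    (2 * p - 1) * (1 - 2 * ρ) / ((2 * Y - 1) * (2 * Y + 1)) * (jacShift p ρ X *
        ((X - Y + g) * (X + Y + g) / ((X - Y) * (X + Y))) +
      jacShift p ρ (-X) *
        ((X - Y - g) * (X + Y - g) / ((X - Y) * (X + Y)))) +
    (2 * p - 1) * (1 - 2 * ρ) / ((2 * X - 1) * (2 * X + 1)) * (jacShift p ρ Y *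
        ((X - Y - g) * (X + Y + g) / ((X - Y) * (X + Y))) +
      jacShift p ρ (-Y) *
        ((X - Y + g) * (X + Y - g) / ((X - Y) * (X + Y)))) = 1 := by
  -- One reduction for each choice of signs of `X` and `Y`, corresponding to the four diagonal moves
  -- in `(n, k)`.
  have hpp := double_shift_add X Y p ρ g hX hX1 hY hY1 h0 h1
  have hmm := double_shift_add (-X) (-Y) p ρ g (neg_ne_zero.2 hX)
    (by intro h; apply hX2; linarith) (neg_ne_zero.2 hY) (by intro h; apply hY2; linarith)
    (by intro h; apply h0; linarith) (by intro h; apply h2; linarith)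
  have hpm := double_shift_add X (-Y) p ρ g hX hX1 (neg_ne_zero.2 hY)
    (by intro h; apply hY2; linarith) (by intro h; apply h0'; linarith)
    (by intro h; apply h1'; linarith)
  have hmp := double_shift_add (-X) Y p ρ g (neg_ne_zero.2 hX)
    (by intro h; apply hX2; linarith) hY hY1
    (by intro h; apply h0'; linarith) (by intro h; apply h2'; linarith)
  rw [show (-X + -Y + g) * (-X + -Y + g + 1) / ((-X + -Y) * (-X + -Y + 1)) =
        (X + Y - g) * (X + Y - g - 1) / ((X + Y) * (X + Y - 1)) by congr 1 <;> ring,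
    show (-X + -Y + g) * (-X + -Y + 1 - g) / ((-X + -Y) * (-X + -Y + 1)) =
        (X + Y - g) * (X + Y - 1 + g) / ((X + Y) * (X + Y - 1)) by congr 1 <;> ring,
    show (-X + ρ) * (-Y + ρ) / (2 * -X * (2 * -X + 1) * (2 * -Y * (2 * -Y + 1))) =
        (X - ρ) * (Y - ρ) / (2 * X * (2 * X - 1) * (2 * Y * (2 * Y - 1))) by congr 1 <;> ring,
    show (-X + -Y + g) / (-X + -Y) = (X + Y - g) / (X + Y) by
      rw [← neg_div_neg_eq]; congr 1 <;> ring] at hmm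
  rw [show (X + -Y + g) * (X + -Y + g + 1) / ((X + -Y) * (X + -Y + 1)) =
        (X - Y + g) * (X - Y + g + 1) / ((X - Y) * (X - Y + 1)) by congr 1,
    show (X + -Y + g) * (X + -Y + 1 - g) / ((X + -Y) * (X + -Y + 1)) =
        (X - Y + g) * (X - Y + 1 - g) / ((X - Y) * (X - Y + 1)) by congr 1,
    show (X + ρ) * (-Y + ρ) / (2 * X * (2 * X + 1) * (2 * -Y * (2 * -Y + 1))) =
        -((X + ρ) * (Y - ρ) / (2 * X * (2 * X + 1) * (2 * Y * (2 * Y - 1)))) by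
      rw [← neg_div]; congr 1 <;> ring,
    show (X + -Y + g) / (X + -Y) = (X - Y + g) / (X - Y) by congr 1] at hpm
  rw [show (-X + Y + g) * (-X + Y + g + 1) / ((-X + Y) * (-X + Y + 1)) =
        (X - Y - g) * (X - Y - g - 1) / ((X - Y) * (X - Y - 1)) by congr 1 <;> ring,
    show (-X + Y + g) * (-X + Y + 1 - g) / ((-X + Y) * (-X + Y + 1)) =
        (X - Y - g) * (X - Y - 1 + g) / ((X - Y) * (X - Y - 1)) by congr 1 <;> ring,
    show (-X + ρ) * (Y + ρ) / (2 * -X * (2 * -X + 1) * (2 * Y * (2 * Y + 1))) =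
        -((X - ρ) * (Y + ρ) / (2 * X * (2 * X - 1) * (2 * Y * (2 * Y + 1)))) by
      rw [← neg_div]; congr 1 <;> ring,
    show (-X + Y + g) / (-X + Y) = (X - Y - g) / (X - Y) by
      rw [← neg_div_neg_eq]; congr 1 <;> ring] at hmp
  linear_combination (exp := 1) hpp + hmm + hpm + hmp +
    cancelled_shift_sum X Y p ρ g hX hX1 hX2 hY hY1 hY2 h0 h0'

/-! ## The coefficients in shifted variables -/

/-- Parameters for which none of the uncancelled quotients is singular. -/
structure Regular (α β γ : ℝ) (n k : ℕ) : Prop where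
  X0 : 2 * (n : ℝ) + 2 * γ + α + β + 2 ≠ 0
  X1 : 2 * (n : ℝ) + 2 * γ + α + β + 3 ≠ 0
  X2 : 2 * (n : ℝ) + 2 * γ + α + β + 1 ≠ 0
  Y0 : 2 * (k : ℝ) + α + β + 1 ≠ 0
  Y1 : 2 * (k : ℝ) + α + β + 2 ≠ 0
  Y2 : 2 * (k : ℝ) + α + β ≠ 0
  S0 : (n : ℝ) + k + α + β + γ + 3 / 2 ≠ 0
  S1 : (n : ℝ) + k + α + β + γ + 5 / 2 ≠ 0
  S2 : (n : ℝ) + k + α + β + γ + 1 / 2 ≠ 0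
  D0 : (n : ℝ) - k + γ + 1 / 2 ≠ 0
  D1 : (n : ℝ) - k + γ + 3 / 2 ≠ 0
  D2 : (n : ℝ) - k + γ - 1 / 2 ≠ 0
  N0 : (n : ℝ) + k + α + β ≠ 0
  N1 : (n : ℝ) + k + α + β + 1 ≠ 0
  M1 : (n : ℝ) + k + α + β + 2 * γ + 3 ≠ 0
  M2 : (n : ℝ) - k + 2 * γ + 2 ≠ 0

theorem Regular.symm {α β γ : ℝ} {n k : ℕ} (h : Regular α β γ n k) : Regular β α γ n k := by
  obtain ⟨h1, h2, h3, h4, h5, h6, h7, h8, h9, h10, h11, h12, h13, h14, h15, h16⟩ := h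
  have key : ∀ x y z : ℝ, x + y + z = x + z + y := fun x y z => by ring
  constructor <;> first | assumption | (simpa only [key _ β α] using ‹_›)

theorem jacA_eq_jacShift (α β x : ℝ) :
    jacA α β x = jacShift ((α - β + 1) / 2) ((α + β + 1) / 2) (x + (α + β + 1) / 2) := by
  unfold jacA jacShift
  congr 1 <;> ring

theorem jacC_eq_jacShift (α β x : ℝ) :
    jacC α β x = jacShift ((α - β + 1) / 2) ((α + β + 1) / 2) (-(x + (α + β + 1) / 2)) := by
  unfold jacC jacShift
  congr 1 <;> ring

/-- The factor `2x + α + β + 1` cancels here. The numerator no longer depends on `x`, so the worst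
weight is the one with the smallest denominator. -/
theorem two_mul_jacB_sub_one (α β x : ℝ) (h0 : 2 * x + α + β ≠ 0) (h1 : 2 * x + α + β + 1 ≠ 0)
    (h2 : 2 * x + α + β + 2 ≠ 0) :
    2 * jacB α β x - 1 = (β ^ 2 - α ^ 2) / ((2 * x + α + β) * (2 * x + α + β + 2)) := by
  unfold jacB
  generalize hz : 2 * x + α + β = z at *
  generalize h3 : z + 1 = u at *
  generalize h4 : z + 2 = v at *
  field_simp
  subst h3 h4 hz
  ring

/-- With the three analogues below, this reduces the signs of the single-shift entries of `P` to
those of scalar weights. -/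
theorem a2_eq_mul (α β γ : ℝ) (n k : ℕ) :
    a2 α β γ n k = (2 * bI α β k - 1) * (2 * a α β γ n k) := by
  unfold a2 a
  ring

theorem c2_eq_mul (α β γ : ℝ) (n k : ℕ) :
    c2 α β γ n k = (2 * bI α β k - 1) * (2 * c α β γ n k) := by
  unfold c2 c
  ring

theorem b1_eq_mul (α β γ : ℝ) (n k : ℕ) :
    b1 α β γ n k = (2 * jacB α β (n + γ + 1 / 2) - 1) * (2 * d α β γ n k) := by
  unfold b1 d
  ring

theorem b3_eq_mul (α β γ : ℝ) (n k : ℕ) :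
    b3 α β γ n k = (2 * jacB α β (n + γ + 1 / 2) - 1) * (2 * e α β γ n k) := by
  unfold b3 e
  ring

/-- The four nonnegative contributions to the diagonal of `J₂` coming from one of the two
factorizations. -/
noncomputable def diagPart (α β γ : ℝ) (n k : ℕ) : ℝ :=
  1 / 2 * a3 β α γ n k * ((n + k + α + β + 2) / (n + k + α + β + 2 * γ + 3)) +
  1 / 2 * a1 β α γ n k * (((n : ℝ) - k + 1) / ((n : ℝ) - k + 2 * γ + 2)) +
  1 / 2 * c1 β α γ n k * ((n + k + α + β + 2 * γ + 1) / (n + k + α + β)) +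
  aI β α k * jacC β α (n + γ + 1 / 2) * (((n : ℝ) - k) * ((n : ℝ) - k + 2 * γ) /
    (((n : ℝ) - k + γ + 1 / 2) * ((n : ℝ) - k + γ - 1 / 2)))

section Shifted

variable {α β γ : ℝ} {n k : ℕ} {X Y p ρ g : ℝ}

/-- In centred variables `δ` is a difference of squares, `(x + ρ)² - (y + ρ)²`, so the quotients of
`δ` factor into `X ± Y` and their shifts by `g`. -/
theorem a_eq_shift (h : Regular α β γ n k) (hk : k ≤ n) (hX : X = n + γ + 1 / 2 + (α + β + 1) / 2)
    (hY : Y = k + (α + β + 1) / 2) (hp : p = (α - β + 1) / 2) (hρ : ρ = (α + β + 1) / 2)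
    (hg : g = γ + 1 / 2) :
    a α β γ n k =
      1 / 2 * jacShift p ρ X * ((X - Y + g) * (X + Y + g) / ((X - Y) * (X + Y))) := by
  rw [a_eq α β γ n k hk (by convert h.X0 using 1; ring) ?_, jacA_eq_jacShift]
  · subst hX hY hp hρ hg
    unfold del
    congr 2 <;> ring
  · unfold del
    exact mul_ne_zero (by convert h.D0 using 1; ring) (by convert h.S0 using 1; ring)

theorem c_eq_shift (hX : X = n + γ + 1 / 2 + (α + β + 1) / 2)
    (hY : Y = k + (α + β + 1) / 2) (hp : p = (α - β + 1) / 2) (hρ : ρ = (α + β + 1) / 2)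
    (hg : g = γ + 1 / 2) :
    c α β γ n k =
      1 / 2 * jacShift p ρ (-X) * ((X - Y - g) * (X + Y - g) / ((X - Y) * (X + Y))) := by
  subst hX hY hp hρ hg
  rw [c, jacC_eq_jacShift]
  unfold del
  congr 2 <;> ring

theorem e_eq_shift (h : Regular α β γ n k) (hX : X = n + γ + 1 / 2 + (α + β + 1) / 2)
    (hY : Y = k + (α + β + 1) / 2) (hp : p = (α - β + 1) / 2) (hρ : ρ = (α + β + 1) / 2)
    (hg : g = γ + 1 / 2) :
    e α β γ n k =
      1 / 2 * jacShift p ρ Y * ((X - Y - g) * (X + Y + g) / ((X - Y) * (X + Y))) := by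
  subst hX hY hp hρ hg
  rw [e, aI_eq _ _ _ h.Y0, jacA_eq_jacShift]
  unfold del
  congr 2 <;> ring

theorem del_quotient_eq_shift (hX : X = n + γ + 1 / 2 + (α + β + 1) / 2)
    (hY : Y = k + (α + β + 1) / 2) (hg : g = γ + 1 / 2) :
    del α β (n + γ + 1 / 2) (k - γ - 1 / 2) / del α β (n + γ + 1 / 2) k =
      (X - Y + g) * (X + Y - g) / ((X - Y) * (X + Y)) := by
  subst hX hY hg
  unfold del
  congr 1 <;> ring

theorem Regular.del_ne_zero (h : Regular α β γ n k) : del α β (n + γ + 1 / 2) k ≠ 0 := by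
  unfold del
  exact mul_ne_zero (by convert h.D0 using 1; ring) (by convert h.S0 using 1; ring)

theorem d_eq_shift (h : Regular α β γ n k) (hX : X = n + γ + 1 / 2 + (α + β + 1) / 2)
    (hY : Y = k + (α + β + 1) / 2) (hp : p = (α - β + 1) / 2) (hρ : ρ = (α + β + 1) / 2)
    (hg : g = γ + 1 / 2) :
    d α β γ n k =
      1 / 2 * jacShift p ρ (-Y) * ((X - Y + g) * (X + Y - g) / ((X - Y) * (X + Y))) := by
  rw [d_eq _ _ _ _ _ h.del_ne_zero, del_quotient_eq_shift hX hY hg, cI, jacC_eq_jacShift,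
    ← hY, ← hp, ← hρ]

theorem two_mul_bI_sub_one_eq_shift (h : Regular α β γ n k)
    (hY : Y = k + (α + β + 1) / 2) (hp : p = (α - β + 1) / 2) (hρ : ρ = (α + β + 1) / 2) :
    2 * bI α β k - 1 = (2 * p - 1) * (1 - 2 * ρ) / ((2 * Y - 1) * (2 * Y + 1)) := by
  subst hY hp hρ
  rw [bI_eq _ _ _ h.Y2 h.Y0 h.Y1, two_mul_jacB_sub_one _ _ _ h.Y2 h.Y0 h.Y1]
  congr 1 <;> ring

theorem two_mul_jacB_sub_one_eq_shift (h : Regular α β γ n k)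
    (hX : X = n + γ + 1 / 2 + (α + β + 1) / 2) (hp : p = (α - β + 1) / 2)
    (hρ : ρ = (α + β + 1) / 2) :
    2 * jacB α β (n + γ + 1 / 2) - 1 =
      (2 * p - 1) * (1 - 2 * ρ) / ((2 * X - 1) * (2 * X + 1)) := by
  subst hX hp hρ
  rw [two_mul_jacB_sub_one _ _ _ (by convert h.X2 using 1; ring) (by convert h.X0 using 1; ring)
    (by convert h.X1 using 1; ring)]
  congr 1 <;> ring

theorem a1_eq_shift (h : Regular α β γ n k) (hX : X = n + γ + 1 / 2 + (α + β + 1) / 2)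
    (hY : Y = k + (α + β + 1) / 2) (hp : p = (α - β + 1) / 2) (hρ : ρ = (α + β + 1) / 2)
    (hg : g = γ + 1 / 2) :
    a1 α β γ n k = 2 * jacShift p ρ X * jacShift p ρ (-Y) *
      ((X - Y + g) * (X - Y + g + 1) / ((X - Y) * (X - Y + 1))) := by
  have hQ : ((n : ℝ) - k + 2 * γ + 1) * ((n : ℝ) - k + 2 * γ + 2) /
      (((n : ℝ) - k + γ + 1 / 2) * ((n : ℝ) - k + γ + 3 / 2)) =
      (X - Y + g) * (X - Y + g + 1) / ((X - Y) * (X - Y + 1)) := by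
    rw [hX, hY, hg]
    congr 1 <;> ring
  rw [a1, ratio_eq _ _ _ h.D0, cI, jacA_eq_jacShift, jacC_eq_jacShift, div_mul_div_comm,
    hQ, ← hX, ← hY, ← hp, ← hρ]
  ring

theorem a3_eq_shift (h : Regular α β γ n k) (hk : k ≤ n)
    (hX : X = n + γ + 1 / 2 + (α + β + 1) / 2)
    (hY : Y = k + (α + β + 1) / 2) (hp : p = (α - β + 1) / 2) (hρ : ρ = (α + β + 1) / 2)
    (hg : g = γ + 1 / 2) :
    a3 α β γ n k = 2 * jacShift p ρ X * jacShift p ρ Y *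
      ((X + Y + g) * (X + Y + g + 1) / ((X + Y) * (X + Y + 1))) := by
  have hQ : ((n : ℝ) + k + α + β + 2 * γ + 2) * ((n : ℝ) + k + α + β + 2 * γ + 3) /
      (((n : ℝ) + k + α + β + γ + 3 / 2) * ((n : ℝ) + k + α + β + γ + 5 / 2)) =
      (X + Y + g) * (X + Y + g + 1) / ((X + Y) * (X + Y + 1)) := by
    rw [hX, hY, hg]
    congr 1 <;> ring
  rw [a3, upFactor_eq _ _ _ _ _ hk (by convert h.X0 using 1; ring) h.S0, aI_eq _ _ _ h.Y0,
    jacA_eq_jacShift, jacA_eq_jacShift, mul_assoc (jacShift _ _ _), div_mul_div_comm,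
    hQ, ← hX, ← hY, ← hp, ← hρ]
  ring

theorem c1_eq_shift (hX : X = n + γ + 1 / 2 + (α + β + 1) / 2)
    (hY : Y = k + (α + β + 1) / 2) (hp : p = (α - β + 1) / 2) (hρ : ρ = (α + β + 1) / 2)
    (hg : g = γ + 1 / 2) :
    c1 α β γ n k = 2 * jacShift p ρ (-X) * jacShift p ρ (-Y) *
      ((X + Y - g) * (X + Y - g - 1) / ((X + Y) * (X + Y - 1))) := by
  have hQ : ((n : ℝ) + k + α + β + 1) * ((n : ℝ) + k + α + β) /
      (((n : ℝ) + k + α + β + γ + 1 / 2) * ((n : ℝ) + k + α + β + γ + 3 / 2)) =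
      (X + Y - g) * (X + Y - g - 1) / ((X + Y) * (X + Y - 1)) := by
    rw [hX, hY, hg]
    congr 1 <;> ring
  rw [c1, cI, jacC_eq_jacShift, jacC_eq_jacShift, hQ, ← hX, ← hY, ← hp, ← hρ]
  ring

theorem c3_eq_shift (h : Regular α β γ n k) (hX : X = n + γ + 1 / 2 + (α + β + 1) / 2)
    (hY : Y = k + (α + β + 1) / 2) (hp : p = (α - β + 1) / 2) (hρ : ρ = (α + β + 1) / 2)
    (hg : g = γ + 1 / 2) :
    c3 α β γ n k = 2 * jacShift p ρ (-X) * jacShift p ρ Y *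
      ((X - Y - g) * (X - Y - g - 1) / ((X - Y) * (X - Y - 1))) := by
  have hN := mul_ne_zero h.N1 h.N1
  have hQ : del α β n k * del α β (n - 1 / 2) (k + 1 / 2) /
      (del α β (n + 1 / 2 * (γ - 1 / 2)) (k - 1 / 2 * (γ - 1 / 2)) *
        del α β (n + 1 / 2 * (γ + 1 / 2)) (k - 1 / 2 * (γ + 1 / 2))) =
      (X - Y - g) * (X - Y - g - 1) / ((X - Y) * (X - Y - 1)) := by
    rw [← mul_div_mul_right _ ((X - Y) * (X - Y - 1)) hN, hX, hY, hg]
    unfold del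
    congr 1 <;> ring
  rw [c3, aI_eq _ _ _ h.Y0, jacC_eq_jacShift, jacA_eq_jacShift, hQ, ← hX, ← hY, ← hp, ← hρ]
  ring

/-- Each correction factor in `diagPart` trades one factor of a double shift for its complement,
such as `X + Y + g + 1` for `X + Y + 1 - g`. The fourth term is not written through `c3`, since the
factor to be traded there is `n - k - 1`, which vanishes at `n = k + 1`. -/
theorem diagPart_eq_shift (h : Regular α β γ n k) (hk : k ≤ n)
    (hX : X = n + γ + 1 / 2 + (α + β + 1) / 2)
    (hY : Y = k + (α + β + 1) / 2) (hp : p = (β - α + 1) / 2) (hρ : ρ = (α + β + 1) / 2)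
    (hg : g = γ + 1 / 2) :
    diagPart α β γ n k =
      jacShift p ρ X * jacShift p ρ Y *
        ((X + Y + g) * (X + Y + 1 - g) / ((X + Y) * (X + Y + 1))) +
      jacShift p ρ X * jacShift p ρ (-Y) *
        ((X - Y + g) * (X - Y + 1 - g) / ((X - Y) * (X - Y + 1))) +
      jacShift p ρ (-X) * jacShift p ρ (-Y) *
        ((X + Y - g) * (X + Y - 1 + g) / ((X + Y) * (X + Y - 1))) +
      jacShift p ρ (-X) * jacShift p ρ Y *
        ((X - Y - g) * (X - Y - 1 + g) / ((X - Y) * (X - Y - 1))) := by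
  have hX' : X = n + γ + 1 / 2 + (β + α + 1) / 2 := by rw [hX]; ring
  have hY' : Y = k + (β + α + 1) / 2 := by rw [hY]; ring
  have hρ' : ρ = (β + α + 1) / 2 := by rw [hρ]; ring
  have h1 : X + Y + g + 1 ≠ 0 := by rw [hX, hY, hg]; convert h.M1 using 1; ring
  have h2 : X - Y + g + 1 ≠ 0 := by rw [hX, hY, hg]; convert h.M2 using 1; ring
  have h3 : X + Y - g - 1 ≠ 0 := by rw [hX, hY, hg]; convert h.N0 using 1; ring
  rw [diagPart, a3_eq_shift h.symm hk hX' hY' hp hρ' hg, a1_eq_shift h.symm hX' hY' hp hρ' hg,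
    c1_eq_shift hX' hY' hp hρ' hg, aI_eq _ _ _ h.symm.Y0, jacA_eq_jacShift, jacC_eq_jacShift,
    ← hX', ← hY', ← hp, ← hρ', mul_comm (jacShift p ρ Y)]
  rw [show (n : ℝ) + k + α + β + 2 = X + Y + 1 - g by rw [hX, hY, hg]; ring,
    show (n : ℝ) + k + α + β + 2 * γ + 3 = X + Y + g + 1 by rw [hX, hY, hg]; ring,
    show (n : ℝ) - k + 1 = X - Y + 1 - g by rw [hX, hY, hg]; ring,
    show (n : ℝ) - k + 2 * γ + 2 = X - Y + g + 1 by rw [hX, hY, hg]; ring,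
    show (n : ℝ) + k + α + β + 2 * γ + 1 = X + Y - 1 + g by rw [hX, hY, hg]; ring,
    show (n : ℝ) + k + α + β = X + Y - g - 1 by rw [hX, hY, hg]; ring]
  have h4 : ∀ w u v z q r : ℝ, v ≠ 0 →
      1 / 2 * (2 * w * q * (u * v / z)) * (r / v) = w * q * (u * r / z) := by
    intro w u v z q r hv
    rw [show 1 / 2 * (2 * w * q * (u * v / z)) * (r / v) = w * q * (u * r / z) * (v / v) by ring,
      div_self hv, mul_one]
  rw [h4 _ _ _ _ _ _ h1, h4 _ _ _ _ _ _ h2, h4 _ _ _ _ _ _ h3]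
  congr 2
  rw [hX, hY, hg]
  congr 1 <;> ring

end Shifted

/-- Interchanging `α` and `β` reflects the diagonal coefficient of `J₁`. -/
theorem Regular.b_eq {α β γ : ℝ} {n k : ℕ} (h : Regular α β γ n k) (hk : k ≤ n) :
    b α β γ n k = a β α γ n k + c β α γ n k + d β α γ n k + e β α γ n k := by
  obtain ⟨X, hX⟩ : ∃ X, X = n + γ + 1 / 2 + (α + β + 1) / 2 := ⟨_, rfl⟩
  obtain ⟨Y, hY⟩ : ∃ Y, Y = k + (α + β + 1) / 2 := ⟨_, rfl⟩
  obtain ⟨p, hp⟩ : ∃ p, p = (α - β + 1) / 2 := ⟨_, rfl⟩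
  obtain ⟨ρ, hρ⟩ : ∃ ρ, ρ = (α + β + 1) / 2 := ⟨_, rfl⟩
  obtain ⟨g, hg⟩ : ∃ g, g = γ + 1 / 2 := ⟨_, rfl⟩
  have hX' : X = n + γ + 1 / 2 + (β + α + 1) / 2 := by rw [hX]; ring
  have hY' : Y = k + (β + α + 1) / 2 := by rw [hY]; ring
  have hρ' : ρ = (β + α + 1) / 2 := by rw [hρ]; ring
  -- Swapping `α` and `β` fixes `X`, `Y`, `ρ`, `g` and sends `p` to `1 - p`.
  have hp' : 1 - p = (β - α + 1) / 2 := by rw [hp]; ring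
  have key := single_shift_sum X Y p ρ g
    (by intro h0; apply h.X0; linarith) (by intro h0; apply h.X1; linarith)
    (by intro h0; apply h.X2; linarith) (by intro h0; apply h.Y0; linarith)
    (by intro h0; apply h.Y1; linarith) (by intro h0; apply h.Y2; linarith)
    (by intro h0; apply h.S0; linarith) (by intro h0; apply h.D0; linarith)
  rw [b, a_eq_shift h hk hX hY hp hρ hg, c_eq_shift hX hY hp hρ hg,
    d_eq_shift h hX hY hp hρ hg, e_eq_shift h hX hY hp hρ hg,
    a_eq_shift h.symm hk hX' hY' hp' hρ' hg, c_eq_shift hX' hY' hp' hρ' hg,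
    d_eq_shift h.symm hX' hY' hp' hρ' hg, e_eq_shift h.symm hX' hY' hp' hρ' hg]
  linear_combination -(1 / 2) * key

/-- The diagonal coefficient of `J₂` as a sum of nonnegative contributions. -/
theorem Regular.b2_eq {α β γ : ℝ} {n k : ℕ} (h : Regular α β γ n k) (hk : k ≤ n) :
    b2 α β γ n k = diagPart α β γ n k + diagPart β α γ n k := by
  obtain ⟨X, hX⟩ : ∃ X, X = n + γ + 1 / 2 + (α + β + 1) / 2 := ⟨_, rfl⟩
  obtain ⟨Y, hY⟩ : ∃ Y, Y = k + (α + β + 1) / 2 := ⟨_, rfl⟩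
  obtain ⟨p, hp⟩ : ∃ p, p = (α - β + 1) / 2 := ⟨_, rfl⟩
  obtain ⟨ρ, hρ⟩ : ∃ ρ, ρ = (α + β + 1) / 2 := ⟨_, rfl⟩
  obtain ⟨g, hg⟩ : ∃ g, g = γ + 1 / 2 := ⟨_, rfl⟩
  have hX' : X = n + γ + 1 / 2 + (β + α + 1) / 2 := by rw [hX]; ring
  have hY' : Y = k + (β + α + 1) / 2 := by rw [hY]; ring
  have hρ' : ρ = (β + α + 1) / 2 := by rw [hρ]; ring
  have hp' : 1 - p = (β - α + 1) / 2 := by rw [hp]; ring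
  have key := double_shift_sum X Y p ρ g
    (by intro h0; apply h.X0; linarith) (by intro h0; apply h.X1; linarith)
    (by intro h0; apply h.X2; linarith) (by intro h0; apply h.Y0; linarith)
    (by intro h0; apply h.Y1; linarith) (by intro h0; apply h.Y2; linarith)
    (by intro h0; apply h.S0; linarith) (by intro h0; apply h.S1; linarith)
    (by intro h0; apply h.S2; linarith) (by intro h0; apply h.D0; linarith)
    (by intro h0; apply h.D1; linarith) (by intro h0; apply h.D2; linarith)
  rw [b2, a2_eq_mul, b1_eq_mul, b3_eq_mul, c2_eq_mul,
    a_eq_shift h hk hX hY hp hρ hg, c_eq_shift hX hY hp hρ hg,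
    d_eq_shift h hX hY hp hρ hg, e_eq_shift h hX hY hp hρ hg,
    two_mul_bI_sub_one_eq_shift h hY hp hρ, two_mul_jacB_sub_one_eq_shift h hX hp hρ,
    a1_eq_shift h hX hY hp hρ hg, a3_eq_shift h hk hX hY hp hρ hg,
    c1_eq_shift hX hY hp hρ hg, c3_eq_shift h hX hY hp hρ hg,
    diagPart_eq_shift h hk hX hY hp' hρ hg, diagPart_eq_shift h.symm hk hX' hY' hp hρ' hg]
  linear_combination -key

/-! ## Nonnegativity of the off-diagonal coefficients -/

/-- Parameters for which all coefficients off the diagonal of `J₁` and all double shifts of `J₂`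
are nonnegative. -/
structure Admissible (α β γ : ℝ) : Prop where
  hα : -1 < α
  hβ : -1 < β
  hγ : -1 < γ
  hαγ : 0 < α + γ + 3 / 2
  hβγ : 0 < β + γ + 3 / 2

theorem Admissible.symm {α β γ : ℝ} (h : Admissible α β γ) : Admissible β α γ :=
  ⟨h.hβ, h.hα, h.hγ, h.hβγ, h.hαγ⟩

theorem Admissible.add {α β γ t : ℝ} (h : Admissible α β γ) (ht : 0 < t) :
    Admissible (α + t) (β + t) (γ + t) := by
  obtain ⟨h1, h2, h3, h4, h5⟩ := h
  constructor <;> linarith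

theorem one_le_cast {n : ℕ} (hn : n ≠ 0) : (1 : ℝ) ≤ n :=
  Nat.one_le_cast.2 (Nat.one_le_iff_ne_zero.2 hn)

theorem cast_add_one_le {k n : ℕ} (hkn : k < n) : (k : ℝ) + 1 ≤ n := by
  exact_mod_cast hkn

theorem aI_pos {α β : ℝ} (hα : -1 < α) (hβ : -1 < β) (k : ℕ) : 0 < aI α β k := by
  unfold aI jacA
  split_ifs with h
  · apply div_pos <;> linarith
  · have := one_le_cast h
    apply div_pos <;> apply mul_pos <;> linarith

theorem cI_zero (α β : ℝ) : cI α β 0 = 0 := by simp [cI, jacC]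

theorem cI_nonneg {α β : ℝ} (hα : -1 < α) (hβ : -1 < β) (k : ℕ) : 0 ≤ cI α β k := by
  rcases eq_or_ne k 0 with rfl | h
  · rw [cI_zero]
  · have := one_le_cast h
    unfold cI jacC
    apply div_nonneg <;> apply mul_nonneg <;> linarith

theorem ratio_pos {γ : ℝ} (hγ : -1 < γ) {n k : ℕ} (hk : k ≤ n) : 0 < ratio γ n k := by
  unfold ratio
  split_ifs with h
  · norm_num
  · have := cast_add_one_le (lt_of_le_of_ne hk h)
    apply div_pos <;> linarith

namespace Admissible

variable {α β γ : ℝ} {n k : ℕ}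

theorem jacA_pos (h : Admissible α β γ) (hn : n ≠ 0) : 0 < jacA α β (n + γ + 1 / 2) := by
  obtain ⟨h1, h2, h3, h4, h5⟩ := h
  have := one_le_cast hn
  unfold jacA
  apply div_pos <;> apply mul_pos <;> linarith

theorem jacC_pos (h : Admissible α β γ) (hn : n ≠ 0) : 0 < jacC α β (n + γ + 1 / 2) := by
  obtain ⟨h1, h2, h3, h4, h5⟩ := h
  have := one_le_cast hn
  unfold jacC
  apply div_pos <;> apply mul_pos <;> linarith

theorem upFactor_pos (h : Admissible α β γ) : 0 < upFactor α β γ n k := by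
  unfold upFactor
  have hk0 := Nat.cast_nonneg (α := ℝ) k
  split_ifs with hn
  · obtain ⟨h1, h2, h3, h4, h5⟩ := h
    apply div_pos <;> linarith
  · have := one_le_cast hn
    refine mul_pos (h.jacA_pos hn) ?_
    obtain ⟨h1, h2, h3, h4, h5⟩ := h
    apply div_pos <;> linarith

theorem a_nonneg (h : Admissible α β γ) (hk : k ≤ n) : 0 ≤ a α β γ n k := by
  have := h.upFactor_pos (n := n) (k := k)
  have := ratio_pos h.hγ hk
  unfold a
  positivity

theorem c_nonneg (h : Admissible α β γ) (hk : k ≤ n) : 0 ≤ c α β γ n k := by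
  unfold c
  rcases hk.eq_or_lt with rfl | hk
  · simp [del]
  · have hn : n ≠ 0 := by omega
    refine mul_nonneg (mul_nonneg (by norm_num) (h.jacC_pos hn).le) ?_
    obtain ⟨h1, h2, h3, h4, h5⟩ := h
    have := cast_add_one_le hk
    have hk0 := Nat.cast_nonneg (α := ℝ) k
    unfold del
    apply div_nonneg <;> apply mul_nonneg <;> linarith

theorem e_nonneg (h : Admissible α β γ) (hk : k ≤ n) : 0 ≤ e α β γ n k := by
  unfold e
  rcases hk.eq_or_lt with rfl | hk
  · simp [del]
  · refine mul_nonneg (mul_nonneg (by norm_num) (aI_pos h.hα h.hβ k).le) ?_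
    obtain ⟨h1, h2, h3, h4, h5⟩ := h
    have := cast_add_one_le hk
    have hk0 := Nat.cast_nonneg (α := ℝ) k
    unfold del
    apply div_nonneg <;> apply mul_nonneg <;> linarith

theorem d_nonneg (h : Admissible α β γ) (hk : k ≤ n) : 0 ≤ d α β γ n k := by
  unfold d
  rcases eq_or_ne k 0 with rfl | h0
  · simp [cI_zero]
  · refine mul_nonneg (mul_nonneg (by norm_num) (cI_nonneg h.hα h.hβ k))
      (mul_nonneg (ratio_pos h.hγ hk).le ?_)
    obtain ⟨h1, h2, h3, h4, h5⟩ := h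
    have := one_le_cast h0
    have : (k : ℝ) ≤ n := Nat.cast_le.2 hk
    apply div_nonneg <;> linarith

theorem a1_nonneg (h : Admissible α β γ) (hk : k ≤ n) : 0 ≤ a1 α β γ n k := by
  unfold a1
  rcases eq_or_ne k 0 with rfl | h0
  · simp [cI_zero]
  · refine mul_nonneg (mul_nonneg (mul_nonneg (by norm_num) (cI_nonneg h.hα h.hβ k))
      (h.jacA_pos (by omega)).le) (mul_nonneg (ratio_pos h.hγ hk).le ?_)
    have := h.hγ
    have : (k : ℝ) ≤ n := Nat.cast_le.2 hk
    apply div_nonneg <;> linarith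

theorem a3_nonneg (h : Admissible α β γ) : 0 ≤ a3 α β γ n k := by
  unfold a3
  refine mul_nonneg (mul_nonneg (by norm_num) (aI_pos h.hα h.hβ k).le)
    (mul_nonneg h.upFactor_pos.le ?_)
  obtain ⟨h1, h2, h3, h4, h5⟩ := h
  have hk0 := Nat.cast_nonneg (α := ℝ) k
  have hn0 := Nat.cast_nonneg (α := ℝ) n
  apply div_nonneg <;> linarith

theorem c1_nonneg (h : Admissible α β γ) (hk : k ≤ n) : 0 ≤ c1 α β γ n k := by
  unfold c1
  rcases eq_or_ne k 0 with rfl | h0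
  · simp [cI_zero]
  · refine mul_nonneg (mul_nonneg (mul_nonneg (by norm_num) (cI_nonneg h.hα h.hβ k))
      (h.jacC_pos (by omega)).le) ?_
    obtain ⟨h1, h2, h3, h4, h5⟩ := h
    have := one_le_cast h0
    have : (k : ℝ) ≤ n := Nat.cast_le.2 hk
    apply div_nonneg <;> apply mul_nonneg <;> linarith

theorem c3_nonneg (h : Admissible α β γ) (hk : k ≤ n) : 0 ≤ c3 α β γ n k := by
  unfold c3
  rcases hk.eq_or_lt with rfl | hk
  · simp [del]
  -- At `n = k + 1` the denominator factor `n - k + γ - 1/2` need not be positive, but the numerator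
  -- contains `n - k - 1 = 0`.
  rcases (Nat.succ_le_of_lt hk).eq_or_lt with rfl | hk'
  · have h0 : (((k + 1 : ℕ) : ℝ) - 1 / 2 - (k + 1 / 2)) = 0 := by push_cast; ring
    simp only [del, Nat.succ_eq_add_one, h0, zero_mul, mul_zero, zero_div, le_refl]
  · refine mul_nonneg (mul_nonneg (mul_nonneg (by norm_num) (aI_pos h.hα h.hβ k).le)
      (h.jacC_pos (by omega)).le) ?_
    obtain ⟨h1, h2, h3, h4, h5⟩ := h
    have : (k : ℝ) + 2 ≤ n := by exact_mod_cast hk'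
    have hk0 := Nat.cast_nonneg (α := ℝ) k
    unfold del
    apply div_nonneg <;> apply mul_nonneg <;> apply mul_nonneg <;> linarith

theorem diagPart_nonneg (h : Admissible α β γ) (hk : k ≤ n) : 0 ≤ diagPart α β γ n k := by
  have h3 := h.symm.a3_nonneg (n := n) (k := k)
  have h1 := h.symm.a1_nonneg hk
  have h4 := h.symm.c1_nonneg hk
  have hk0 := Nat.cast_nonneg (α := ℝ) k
  have hkn : (k : ℝ) ≤ n := Nat.cast_le.2 hk
  obtain ⟨i1, i2, i3, i4, i5⟩ := id h
  unfold diagPart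
  refine add_nonneg (add_nonneg (add_nonneg ?_ ?_) ?_) ?_
  · refine mul_nonneg (by positivity) ?_
    apply div_nonneg <;> linarith
  · refine mul_nonneg (by positivity) ?_
    apply div_nonneg <;> linarith
  -- The denominator `n + k + α + β` may fail to be positive when `k = 0`; there `c_0 = 0`.
  · rcases eq_or_ne k 0 with rfl | h0
    · simp [c1, cI_zero]
    · have := one_le_cast h0
      refine mul_nonneg (by positivity) ?_
      apply div_nonneg <;> linarith
  · rcases hk.eq_or_lt with rfl | hk
    · simp
    refine mul_nonneg (mul_nonneg (aI_pos i2 i1 k).le (h.symm.jacC_pos (by omega)).le) ?_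
    have := cast_add_one_le hk
    rcases (Nat.succ_le_of_lt hk).eq_or_lt with rfl | hk'
    -- For `n = k + 1` numerator and denominator share the factor `γ + 1/2`, of either sign. At `γ =
    -- -1/2` the quotient is `0 / 0 = 0`, which is still nonnegative.
    · rw [show (((k + 1 : ℕ) : ℝ) - k) * (((k + 1 : ℕ) : ℝ) - k + 2 * γ) /
        ((((k + 1 : ℕ) : ℝ) - k + γ + 1 / 2) * (((k + 1 : ℕ) : ℝ) - k + γ - 1 / 2)) =
        2 / (γ + 3 / 2) * ((γ + 1 / 2) / (γ + 1 / 2)) by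
          rw [div_mul_div_comm]; push_cast; congr 1 <;> ring]
      refine mul_nonneg (div_nonneg (by norm_num) (by linarith)) ?_
      rcases eq_or_ne (γ + 1 / 2) 0 with h0 | h0
      · simp only [h0, div_zero, le_refl]
      · simp only [div_self h0, zero_le_one]
    · have : (k : ℝ) + 2 ≤ n := by exact_mod_cast hk'
      apply div_nonneg <;> apply mul_nonneg <;> linarith

end Admissible

/-! ## Continuity in the parameters -/

namespace Admissible

variable {α β γ : ℝ} {n k : ℕ}

theorem continuousAt_aI (h : Admissible α β γ) :
    ContinuousAt (fun q : ℝ × ℝ × ℝ => aI q.1 q.2.1 k) (α, β, γ) := by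
  obtain ⟨h1, h2, h3, h4, h5⟩ := h
  unfold aI jacA
  split_ifs with hk
  · exact ContinuousAt.div (by fun_prop) (by fun_prop) (ne_of_gt (by dsimp only; linarith))
  · have := one_le_cast hk
    refine ContinuousAt.div (by fun_prop) (by fun_prop) (ne_of_gt ?_)
    apply mul_pos <;> dsimp only <;> linarith

theorem continuousAt_bI (h : Admissible α β γ) :
    ContinuousAt (fun q : ℝ × ℝ × ℝ => bI q.1 q.2.1 k) (α, β, γ) := by
  obtain ⟨h1, h2, h3, h4, h5⟩ := h
  unfold bI jacB
  split_ifs with hk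
  · exact ContinuousAt.div (by fun_prop) (by fun_prop) (ne_of_gt (by dsimp only; linarith))
  · have := one_le_cast hk
    refine ContinuousAt.add (ContinuousAt.div (by fun_prop) (by fun_prop) (ne_of_gt ?_))
      (ContinuousAt.div (by fun_prop) (by fun_prop) (ne_of_gt ?_)) <;>
    apply mul_pos <;> dsimp only <;> linarith

/-- At `k = 0` the denominator may vanish nearby, but the numerator is identically zero, so division
by zero creates no jump. -/
theorem continuousAt_cI (h : Admissible α β γ) :
    ContinuousAt (fun q : ℝ × ℝ × ℝ => cI q.1 q.2.1 k) (α, β, γ) := by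
  obtain ⟨h1, h2, h3, h4, h5⟩ := h
  rcases eq_or_ne k 0 with rfl | hk
  · simp only [cI_zero]
    exact continuousAt_const
  · have := one_le_cast hk
    unfold cI jacC
    refine ContinuousAt.div (by fun_prop) (by fun_prop) (ne_of_gt ?_)
    apply mul_pos <;> dsimp only <;> linarith

theorem continuousAt_jacA (h : Admissible α β γ) (hn : n ≠ 0) :
    ContinuousAt (fun q : ℝ × ℝ × ℝ => jacA q.1 q.2.1 (n + q.2.2 + 1 / 2)) (α, β, γ) := by
  obtain ⟨h1, h2, h3, h4, h5⟩ := h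
  have := one_le_cast hn
  unfold jacA
  refine ContinuousAt.div (by fun_prop) (by fun_prop) (ne_of_gt ?_)
  apply mul_pos <;> dsimp only <;> linarith

theorem continuousAt_jacB (h : Admissible α β γ) (hn : n ≠ 0) :
    ContinuousAt (fun q : ℝ × ℝ × ℝ => jacB q.1 q.2.1 (n + q.2.2 + 1 / 2)) (α, β, γ) := by
  obtain ⟨h1, h2, h3, h4, h5⟩ := h
  have := one_le_cast hn
  unfold jacB
  refine ContinuousAt.add (ContinuousAt.div (by fun_prop) (by fun_prop) (ne_of_gt ?_))
    (ContinuousAt.div (by fun_prop) (by fun_prop) (ne_of_gt ?_)) <;>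
  apply mul_pos <;> dsimp only <;> linarith

theorem continuousAt_jacC (h : Admissible α β γ) (hn : n ≠ 0) :
    ContinuousAt (fun q : ℝ × ℝ × ℝ => jacC q.1 q.2.1 (n + q.2.2 + 1 / 2)) (α, β, γ) := by
  obtain ⟨h1, h2, h3, h4, h5⟩ := h
  have := one_le_cast hn
  unfold jacC
  refine ContinuousAt.div (by fun_prop) (by fun_prop) (ne_of_gt ?_)
  apply mul_pos <;> dsimp only <;> linarith

theorem continuousAt_ratio (h : Admissible α β γ) (hk : k ≤ n) :
    ContinuousAt (fun q : ℝ × ℝ × ℝ => ratio q.2.2 n k) (α, β, γ) := by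
  unfold ratio
  split_ifs with hkn
  · exact continuousAt_const
  · have := cast_add_one_le (lt_of_le_of_ne hk hkn)
    have := h.hγ
    exact ContinuousAt.div (by fun_prop) (by fun_prop) (ne_of_gt (by dsimp only; linarith))

theorem continuousAt_upFactor (h : Admissible α β γ) :
    ContinuousAt (fun q : ℝ × ℝ × ℝ => upFactor q.1 q.2.1 q.2.2 n k) (α, β, γ) := by
  have hk0 := Nat.cast_nonneg (α := ℝ) k
  obtain ⟨h1, h2, h3, h4, h5⟩ := id h
  unfold upFactor
  split_ifs with hn
  · exact ContinuousAt.div (by fun_prop) (by fun_prop) (ne_of_gt (by dsimp only; linarith))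
  · have := one_le_cast hn
    exact (h.continuousAt_jacA hn).mul
      (ContinuousAt.div (by fun_prop) (by fun_prop) (ne_of_gt (by dsimp only; linarith)))

theorem continuousAt_a (h : Admissible α β γ) (hk : k ≤ n) :
    ContinuousAt (fun q : ℝ × ℝ × ℝ => a q.1 q.2.1 q.2.2 n k) (α, β, γ) :=
  (continuousAt_const.mul h.continuousAt_upFactor).mul (h.continuousAt_ratio hk)

theorem continuousAt_c (h : Admissible α β γ) (hk : k ≤ n) :
    ContinuousAt (fun q : ℝ × ℝ × ℝ => c q.1 q.2.1 q.2.2 n k) (α, β, γ) := by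
  rcases hk.eq_or_lt with rfl | hk
  · simp only [c, del, sub_self, zero_mul, zero_div, mul_zero]
    exact continuousAt_const
  · have hk0 := Nat.cast_nonneg (α := ℝ) k
    have := cast_add_one_le hk
    refine (continuousAt_const.mul (h.continuousAt_jacC (by omega))).mul ?_
    obtain ⟨h1, h2, h3, h4, h5⟩ := h
    unfold del
    refine ContinuousAt.div (by fun_prop) (by fun_prop) (ne_of_gt ?_)
    apply mul_pos <;> dsimp only <;> linarith

theorem continuousAt_e (h : Admissible α β γ) (hk : k ≤ n) :
    ContinuousAt (fun q : ℝ × ℝ × ℝ => e q.1 q.2.1 q.2.2 n k) (α, β, γ) := by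
  rcases hk.eq_or_lt with rfl | hk
  · simp only [e, del, sub_self, zero_mul, zero_div, mul_zero]
    exact continuousAt_const
  · have hk0 := Nat.cast_nonneg (α := ℝ) k
    have := cast_add_one_le hk
    refine (continuousAt_const.mul h.continuousAt_aI).mul ?_
    obtain ⟨h1, h2, h3, h4, h5⟩ := h
    unfold del
    refine ContinuousAt.div (by fun_prop) (by fun_prop) (ne_of_gt ?_)
    apply mul_pos <;> dsimp only <;> linarith

theorem continuousAt_d (h : Admissible α β γ) (hk : k ≤ n) :
    ContinuousAt (fun q : ℝ × ℝ × ℝ => d q.1 q.2.1 q.2.2 n k) (α, β, γ) := by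
  rcases eq_or_ne k 0 with rfl | h0
  · simp only [d, cI_zero, mul_zero, zero_mul]
    exact continuousAt_const
  · have := one_le_cast h0
    have : (k : ℝ) ≤ n := Nat.cast_le.2 hk
    refine (continuousAt_const.mul h.continuousAt_cI).mul ((h.continuousAt_ratio hk).mul ?_)
    obtain ⟨h1, h2, h3, h4, h5⟩ := h
    exact ContinuousAt.div (by fun_prop) (by fun_prop) (ne_of_gt (by dsimp only; linarith))

theorem continuousAt_b (h : Admissible α β γ) (hk : k ≤ n) :
    ContinuousAt (fun q : ℝ × ℝ × ℝ => b q.1 q.2.1 q.2.2 n k) (α, β, γ) :=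
  (((continuousAt_const.sub (h.continuousAt_a hk)).sub (h.continuousAt_c hk)).sub
    (h.continuousAt_d hk)).sub (h.continuousAt_e hk)

theorem continuousAt_a1 (h : Admissible α β γ) (hk : k ≤ n) :
    ContinuousAt (fun q : ℝ × ℝ × ℝ => a1 q.1 q.2.1 q.2.2 n k) (α, β, γ) := by
  rcases eq_or_ne k 0 with rfl | h0
  · simp only [a1, cI_zero, mul_zero, zero_mul]
    exact continuousAt_const
  · have := h.hγ
    have : (k : ℝ) ≤ n := Nat.cast_le.2 hk
    refine ((continuousAt_const.mul h.continuousAt_cI).mul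
      (h.continuousAt_jacA (by omega))).mul ((h.continuousAt_ratio hk).mul ?_)
    exact ContinuousAt.div (by fun_prop) (by fun_prop) (ne_of_gt (by dsimp only; linarith))

theorem continuousAt_a3 (h : Admissible α β γ) :
    ContinuousAt (fun q : ℝ × ℝ × ℝ => a3 q.1 q.2.1 q.2.2 n k) (α, β, γ) := by
  refine (continuousAt_const.mul h.continuousAt_aI).mul (h.continuousAt_upFactor.mul ?_)
  have hk0 := Nat.cast_nonneg (α := ℝ) k
  have hn0 := Nat.cast_nonneg (α := ℝ) n
  obtain ⟨h1, h2, h3, h4, h5⟩ := h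
  exact ContinuousAt.div (by fun_prop) (by fun_prop) (ne_of_gt (by dsimp only; linarith))

theorem continuousAt_c1 (h : Admissible α β γ) (hk : k ≤ n) :
    ContinuousAt (fun q : ℝ × ℝ × ℝ => c1 q.1 q.2.1 q.2.2 n k) (α, β, γ) := by
  rcases eq_or_ne k 0 with rfl | h0
  · simp only [c1, cI_zero, mul_zero, zero_mul]
    exact continuousAt_const
  · have := one_le_cast h0
    have : (k : ℝ) ≤ n := Nat.cast_le.2 hk
    refine ((continuousAt_const.mul h.continuousAt_cI).mul
      (h.continuousAt_jacC (by omega))).mul ?_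
    obtain ⟨h1, h2, h3, h4, h5⟩ := h
    refine ContinuousAt.div (by fun_prop) (by fun_prop) (ne_of_gt ?_)
    apply mul_pos <;> dsimp only <;> linarith

theorem continuousAt_c3 (h : Admissible α β γ) (hk : k ≤ n) :
    ContinuousAt (fun q : ℝ × ℝ × ℝ => c3 q.1 q.2.1 q.2.2 n k) (α, β, γ) := by
  rcases hk.eq_or_lt with rfl | hk
  · simp only [c3, del, sub_self, zero_mul, zero_div, mul_zero]
    exact continuousAt_const
  rcases (Nat.succ_le_of_lt hk).eq_or_lt with rfl | hk'
  · have h0 : (((k + 1 : ℕ) : ℝ) - 1 / 2 - (k + 1 / 2)) = 0 := by push_cast; ring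
    simp only [c3, del, Nat.succ_eq_add_one, h0, zero_mul, mul_zero, zero_div]
    exact continuousAt_const
  · have : (k : ℝ) + 2 ≤ n := by exact_mod_cast hk'
    have hk0 := Nat.cast_nonneg (α := ℝ) k
    refine ((continuousAt_const.mul h.continuousAt_aI).mul
      (h.continuousAt_jacC (by omega))).mul ?_
    obtain ⟨h1, h2, h3, h4, h5⟩ := h
    unfold del
    refine ContinuousAt.div (by fun_prop) (by fun_prop) (ne_of_gt ?_)
    apply mul_pos <;> apply mul_pos <;> dsimp only <;> linarith

/-- Level `0` is separate because `jacB` can have a pole at `γ + 1/2`; the factor `c_0 = 0` makes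
the coefficient identically zero there. -/
theorem continuousAt_b1 (h : Admissible α β γ) (hk : k ≤ n) :
    ContinuousAt (fun q : ℝ × ℝ × ℝ => b1 q.1 q.2.1 q.2.2 n k) (α, β, γ) := by
  rcases eq_or_ne n 0 with rfl | hn
  · obtain rfl : k = 0 := by omega
    simp only [b1, cI_zero, mul_zero, zero_mul]
    exact continuousAt_const
  · simp only [b1_eq_mul]
    exact ((continuousAt_const.mul (h.continuousAt_jacB hn)).sub continuousAt_const).mul
      (continuousAt_const.mul (h.continuousAt_d hk))

theorem continuousAt_b3 (h : Admissible α β γ) (hk : k ≤ n) :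
    ContinuousAt (fun q : ℝ × ℝ × ℝ => b3 q.1 q.2.1 q.2.2 n k) (α, β, γ) := by
  rcases eq_or_ne n 0 with rfl | hn
  · obtain rfl : k = 0 := by omega
    simp only [b3, del, sub_self, zero_mul, mul_zero, zero_div]
    exact continuousAt_const
  · simp only [b3_eq_mul]
    exact ((continuousAt_const.mul (h.continuousAt_jacB hn)).sub continuousAt_const).mul
      (continuousAt_const.mul (h.continuousAt_e hk))

theorem continuousAt_b2 (h : Admissible α β γ) (hk : k ≤ n) :
    ContinuousAt (fun q : ℝ × ℝ × ℝ => b2 q.1 q.2.1 q.2.2 n k) (α, β, γ) := by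
  have ha2 : ContinuousAt (fun q : ℝ × ℝ × ℝ => a2 q.1 q.2.1 q.2.2 n k) (α, β, γ) := by
    simp only [a2_eq_mul]
    exact ((continuousAt_const.mul h.continuousAt_bI).sub continuousAt_const).mul
      (continuousAt_const.mul (h.continuousAt_a hk))
  have hc2 : ContinuousAt (fun q : ℝ × ℝ × ℝ => c2 q.1 q.2.1 q.2.2 n k) (α, β, γ) := by
    simp only [c2_eq_mul]
    exact ((continuousAt_const.mul h.continuousAt_bI).sub continuousAt_const).mul
      (continuousAt_const.mul (h.continuousAt_c hk))
  exact (((((((continuousAt_const.sub (h.continuousAt_b1 hk)).sub (h.continuousAt_b3 hk)).sub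
    (h.continuousAt_a1 hk)).sub ha2).sub h.continuousAt_a3).sub (h.continuousAt_c1 hk)).sub
    hc2).sub (h.continuousAt_c3 hk)

end Admissible

/-! ## Nonnegativity of the diagonal coefficients -/

section Limit

open Filter Topology

/-- The single zero `-u / v` is either `0` itself, which is excluded, or at positive distance from
it. -/
theorem eventually_add_mul_ne_zero (u : ℝ) {v : ℝ} (hv : v ≠ 0) :
    ∀ᶠ t in 𝓝[>] (0 : ℝ), u + v * t ≠ 0 := by
  have h : ∀ᶠ t in 𝓝[≠] (0 : ℝ), t ≠ -u / v := by
    rcases eq_or_ne (-u / v) 0 with h0 | h0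
    · rw [h0]
      exact eventually_mem_nhdsWithin
    · exact eventually_nhdsWithin_of_eventually_nhds (isOpen_ne.mem_nhds h0.symm)
  filter_upwards [nhdsWithin_mono _ (fun t (ht : 0 < t) => ne_of_gt ht) h] with t ht h0
  apply ht
  rw [eq_div_iff hv]
  linarith

/-- Along the direction `(1, 1, 1)` each of the sixteen linear forms has positive slope, and the
same direction preserves admissibility. -/
theorem eventually_regular (α β γ : ℝ) (n k : ℕ) :
    ∀ᶠ t in 𝓝[>] (0 : ℝ), Regular (α + t) (β + t) (γ + t) n k := by
  filter_upwards [
    eventually_add_mul_ne_zero (2 * (n : ℝ) + 2 * γ + α + β + 2) (v := 4) (by norm_num),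
    eventually_add_mul_ne_zero (2 * (n : ℝ) + 2 * γ + α + β + 3) (v := 4) (by norm_num),
    eventually_add_mul_ne_zero (2 * (n : ℝ) + 2 * γ + α + β + 1) (v := 4) (by norm_num),
    eventually_add_mul_ne_zero (2 * (k : ℝ) + α + β + 1) (v := 2) (by norm_num),
    eventually_add_mul_ne_zero (2 * (k : ℝ) + α + β + 2) (v := 2) (by norm_num),
    eventually_add_mul_ne_zero (2 * (k : ℝ) + α + β) (v := 2) (by norm_num),
    eventually_add_mul_ne_zero ((n : ℝ) + k + α + β + γ + 3 / 2) (v := 3) (by norm_num),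
    eventually_add_mul_ne_zero ((n : ℝ) + k + α + β + γ + 5 / 2) (v := 3) (by norm_num),
    eventually_add_mul_ne_zero ((n : ℝ) + k + α + β + γ + 1 / 2) (v := 3) (by norm_num),
    eventually_add_mul_ne_zero ((n : ℝ) - k + γ + 1 / 2) (v := 1) (by norm_num),
    eventually_add_mul_ne_zero ((n : ℝ) - k + γ + 3 / 2) (v := 1) (by norm_num),
    eventually_add_mul_ne_zero ((n : ℝ) - k + γ - 1 / 2) (v := 1) (by norm_num),
    eventually_add_mul_ne_zero ((n : ℝ) + k + α + β) (v := 2) (by norm_num),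
    eventually_add_mul_ne_zero ((n : ℝ) + k + α + β + 1) (v := 2) (by norm_num),
    eventually_add_mul_ne_zero ((n : ℝ) + k + α + β + 2 * γ + 3) (v := 4) (by norm_num),
    eventually_add_mul_ne_zero ((n : ℝ) - k + 2 * γ + 2) (v := 2) (by norm_num)]
    with t h1 h2 h3 h4 h5 h6 h7 h8 h9 h10 h11 h12 h13 h14 h15 h16
  constructor
  · convert h1 using 1; ring
  · convert h2 using 1; ring
  · convert h3 using 1; ring
  · convert h4 using 1; ring
  · convert h5 using 1; ring
  · convert h6 using 1; ring
  · convert h7 using 1; ring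
  · convert h8 using 1; ring
  · convert h9 using 1; ring
  · convert h10 using 1; ring
  · convert h11 using 1; ring
  · convert h12 using 1; ring
  · convert h13 using 1; ring
  · convert h14 using 1; ring
  · convert h15 using 1; ring
  · convert h16 using 1; ring

/-- A coefficient that is continuous in the parameters is nonnegative if it is nonnegative at all
regular parameters. -/
theorem Admissible.nonneg_of_regular {F : ℝ → ℝ → ℝ → ℝ} {α β γ : ℝ} {n k : ℕ}
    (h : Admissible α β γ)
    (hF : ContinuousAt (fun q : ℝ × ℝ × ℝ => F q.1 q.2.1 q.2.2) (α, β, γ))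
    (hreg : ∀ α' β' γ' : ℝ, Admissible α' β' γ' → Regular α' β' γ' n k → 0 ≤ F α' β' γ') :
    0 ≤ F α β γ := by
  have hp : Tendsto (fun t : ℝ => (α + t, β + t, γ + t)) (𝓝[>] 0) (𝓝 (α, β, γ)) := by
    have : Continuous fun t : ℝ => (α + t, β + t, γ + t) := by fun_prop
    have h0 := this.tendsto 0
    simp only [add_zero] at h0
    exact h0.mono_left nhdsWithin_le_nhds
  refine ge_of_tendsto (hF.tendsto.comp hp) ?_
  filter_upwards [eventually_regular α β γ n k, self_mem_nhdsWithin] with t ht h0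
  exact hreg _ _ _ (h.add h0) ht

theorem Admissible.b_nonneg {α β γ : ℝ} {n k : ℕ} (h : Admissible α β γ) (hk : k ≤ n) :
    0 ≤ b α β γ n k := by
  refine h.nonneg_of_regular (F := fun α β γ => b α β γ n k) (h.continuousAt_b hk)
    (n := n) (k := k) fun α' β' γ' h' hr => ?_
  have h1 := h'.symm.a_nonneg hk
  have h2 := h'.symm.c_nonneg hk
  have h3 := h'.symm.d_nonneg hk
  have h4 := h'.symm.e_nonneg hk
  rw [hr.b_eq hk]
  positivity

theorem Admissible.b2_nonneg {α β γ : ℝ} {n k : ℕ} (h : Admissible α β γ) (hk : k ≤ n) :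
    0 ≤ b2 α β γ n k := by
  refine h.nonneg_of_regular (F := fun α β γ => b2 α β γ n k) (h.continuousAt_b2 hk)
    (n := n) (k := k) fun α' β' γ' h' hr => ?_
  rw [hr.b2_eq hk]
  exact add_nonneg (h'.diagPart_nonneg hk) (h'.symm.diagPart_nonneg hk)

end Limit

/-! ## Row sums -/

/-- The three vanishing hypotheses are the ways a band can stick out of a block with `N` columns. In
use `N` is `n + 2`, `n + 1` or `n`, so only the downward block can lose its middle entry. -/
theorem sum_tridiag {l m u : ℕ → ℝ} {k N : ℕ} (hN : k ≤ N) (hl : k = 0 → l k = 0)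
    (hm : N = k → m k = 0) (hu : N ≤ k + 1 → u k = 0) :
    ∑ j : Fin N, tridiag l m u k j = l k + m k + u k := by
  have h : ∀ j, tridiag l m u k j =
      (if k = j + 1 then l k else 0) + (if k = j then m k else 0) +
        (if k + 1 = j then u k else 0) := by
    intro j
    unfold tridiag
    split_ifs <;> first | omega | simp
  rw [Fin.sum_univ_eq_sum_range (fun j => tridiag l m u k j) N]
  simp only [h, Finset.sum_add_distrib, Finset.sum_ite_eq, Finset.mem_range]
  congr 1
  · congr 1
    · rcases k with _ | k
      · simp [hl rfl]
      · simp only [Nat.add_right_cancel_iff, Finset.sum_ite_eq, Finset.mem_range]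
        rw [if_pos (by omega)]
    · split_ifs with h1
      · rfl
      · rw [hm (by omega)]
  · split_ifs with h1
    · rfl
    · rw [hu (by omega)]

/-- The row sums of a block tridiagonal matrix with tridiagonal blocks, if the entries that would
lead outside the state space vanish. -/
theorem hasSum_blockTridiag {a₁ a₂ a₃ b₁ b₂ b₃ c₁ c₂ c₃ : ℕ → ℕ → ℝ} (n : ℕ) (k : Fin (n + 1))
    (ha : (k : ℕ) = 0 → a₁ n k = 0) (hb : (k : ℕ) = 0 → b₁ n k = 0)
    (hb' : (k : ℕ) = n → b₃ n k = 0) (hc : (k : ℕ) = 0 → c₁ n k = 0)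
    (hc' : (k : ℕ) = n → c₂ n k = 0) (hc'' : n ≤ k + 1 → c₃ n k = 0) :
    HasSum (fun t => blockTridiag (fun n => tridiag (a₁ n) (a₂ n) (a₃ n))
        (fun n => tridiag (b₁ n) (b₂ n) (b₃ n)) (fun n => tridiag (c₁ n) (c₂ n) (c₃ n)) ⟨n, k⟩ t)
      ((a₁ n k + a₂ n k + a₃ n k) + (b₁ n k + b₂ n k + b₃ n k) + (c₁ n k + c₂ n k + c₃ n k)) := by
  have hk : (k : ℕ) ≤ n := Nat.lt_succ_iff.1 k.2
  set M := blockTridiag (fun n => tridiag (a₁ n) (a₂ n) (a₃ n))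
    (fun n => tridiag (b₁ n) (b₂ n) (b₃ n)) (fun n => tridiag (c₁ n) (c₂ n) (c₃ n)) with hM
  have hup : ∑ j : Fin (n + 1 + 1), M ⟨n, k⟩ ⟨n + 1, j⟩ = a₁ n k + a₂ n k + a₃ n k := by
    rw [← sum_tridiag (N := n + 1 + 1) (by omega) ha (by omega) (by omega)]
    simp [hM, blockTridiag]
  have hmid : ∑ j : Fin (n + 1), M ⟨n, k⟩ ⟨n, j⟩ = b₁ n k + b₂ n k + b₃ n k := by
    rw [← sum_tridiag (N := n + 1) (by omega) hb (by omega) (fun h => hb' (by omega))]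
    simp [hM, blockTridiag]
  -- A row at level `n` is supported on levels up to `n + 1`, so its sum is finite and can be taken
  -- level by level.
  have hzero : ∀ t : State,
      t ∉ (Finset.range (n + 2)).sigma (fun m => (Finset.univ : Finset (Fin (m + 1)))) →
      M ⟨n, k⟩ t = 0 := by
    intro t ht
    simp only [Finset.mem_sigma, Finset.mem_range, Finset.mem_univ, and_true, not_lt] at ht
    rw [hM]
    unfold blockTridiag
    dsimp only
    rw [if_neg (by omega), if_neg (by omega), if_neg (by omega)]
  have hdown : ∑ m ∈ Finset.range n, ∑ j : Fin (m + 1), M ⟨n, k⟩ ⟨m, j⟩ =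
      c₁ n k + c₂ n k + c₃ n k := by
    rcases n with _ | n
    · rw [hc (by omega), hc' (by omega), hc'' (by omega)]
      simp
    · rw [Finset.sum_range_succ, Finset.sum_eq_zero, zero_add,
        ← sum_tridiag (N := n + 1) (by omega) hc (fun h => hc' h.symm) hc'']
      · simp only [hM, blockTridiag]
        refine Finset.sum_congr rfl fun j _ => ?_
        rw [if_neg (by omega), if_neg (by omega), if_pos trivial]
      · intro m hm
        rw [Finset.mem_range] at hm
        refine Finset.sum_eq_zero fun j _ => ?_
        rw [hM]
        unfold blockTridiag
        dsimp only
        rw [if_neg (by omega), if_neg (by omega), if_neg (by omega)]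
  have h : HasSum (fun t => M ⟨n, k⟩ t) _ := hasSum_sum_of_ne_finset_zero hzero
  rw [Finset.sum_sigma, Finset.sum_range_succ, hup, Finset.sum_range_succ, hmid, hdown] at h
  rwa [show (a₁ n k + a₂ n k + a₃ n k) + (b₁ n k + b₂ n k + b₃ n k) +
    (c₁ n k + c₂ n k + c₃ n k) = c₁ n k + c₂ n k + c₃ n k + (b₁ n k + b₂ n k + b₃ n k) +
    (a₁ n k + a₂ n k + a₃ n k) by ring]

theorem c3_eq_zero (α β γ : ℝ) {n k : ℕ} (hk : k ≤ n) (h : n ≤ k + 1) : c3 α β γ n k = 0 := by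
  obtain rfl | rfl : n = k ∨ n = k + 1 := by omega
  · simp [c3, del]
  · have h0 : (((k + 1 : ℕ) : ℝ) - 1 / 2 - (k + 1 / 2)) = 0 := by push_cast; ring
    simp only [c3, del, h0, zero_mul, mul_zero, zero_div]

theorem rowSumsOne_J1 (α β γ : ℝ) : RowSumsOne (J1 α β γ) := by
  rintro ⟨n, k⟩
  have h := hasSum_blockTridiag (a₁ := fun _ => 0) (a₂ := a α β γ) (a₃ := fun _ => 0)
    (b₁ := d α β γ) (b₂ := b α β γ) (b₃ := e α β γ)
    (c₁ := fun _ => 0) (c₂ := c α β γ) (c₃ := fun _ => 0) n k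
    (fun _ => rfl) (fun h => by simp [d, h, cI_zero]) (fun h => by simp [e, del, h])
    (fun _ => rfl) (fun h => by simp [c, del, h]) (fun _ => rfl)
  have h1 : (0 + a α β γ n k + 0) + (d α β γ n k + b α β γ n k + e α β γ n k) +
      (0 + c α β γ n k + 0) = 1 := by
    rw [b]
    ring
  rw [← h1]
  exact h

theorem rowSumsOne_J2 (α β γ : ℝ) : RowSumsOne (J2 α β γ) := by
  rintro ⟨n, k⟩
  have h := hasSum_blockTridiag (a₁ := a1 α β γ) (a₂ := a2 α β γ) (a₃ := a3 α β γ)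
    (b₁ := b1 α β γ) (b₂ := b2 α β γ) (b₃ := b3 α β γ)
    (c₁ := c1 α β γ) (c₂ := c2 α β γ) (c₃ := c3 α β γ) n k
    (fun h => by simp [a1, h, cI_zero]) (fun h => by simp [b1, h, cI_zero])
    (fun h => by simp [b3, del, h]) (fun h => by simp [c1, h, cI_zero])
    (fun h => by simp [c2, del, h])
    (fun h => c3_eq_zero α β γ (Nat.lt_succ_iff.1 k.2) h)
  rwa [show (a1 α β γ n k + a2 α β γ n k + a3 α β γ n k) +
    (b1 α β γ n k + b2 α β γ n k + b3 α β γ n k) +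
    (c1 α β γ n k + c2 α β γ n k + c3 α β γ n k) = 1 by rw [b2]; ring] at h

theorem rowSumsOne_P (α β γ τ : ℝ) : RowSumsOne (P α β γ τ) := by
  intro s
  have h := ((rowSumsOne_J1 α β γ s).mul_left (1 - τ)).add
    ((rowSumsOne_J2 α β γ s).mul_left τ)
  rw [show (1 - τ) * 1 + τ * 1 = 1 by ring] at h
  exact h

/-! ## The transition matrix -/

theorem isBlockTridiagonal_P (α β γ τ : ℝ) : IsBlockTridiagonal (P α β γ τ) := by
  intro s t h
  have h0 : ∀ A B C, blockTridiag A B C s t = 0 := by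
    intro A B C
    unfold blockTridiag
    rw [if_neg (by omega), if_neg (by omega), if_neg (by omega)]
  simp only [P, J1, J2, Matrix.add_apply, Matrix.smul_apply, h0, smul_zero, add_zero]

theorem mul_tridiag_add_mul_tridiag_nonneg {l m u l' m' u' : ℕ → ℝ} {x y : ℝ} {k : ℕ}
    (hl : 0 ≤ x * l k + y * l' k) (hm : 0 ≤ x * m k + y * m' k) (hu : 0 ≤ x * u k + y * u' k)
    (j : ℕ) : 0 ≤ x * tridiag l m u k j + y * tridiag l' m' u' k j := by
  unfold tridiag
  split_ifs <;> first | assumption | simp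

/-- `P` is the transition matrix of a quasi-birth-and-death process as soon as the single shifts
have nonnegative weights. -/
theorem Admissible.isQBDTransitionMatrix_P {α β γ τ : ℝ} (h : Admissible α β γ) (h0 : 0 ≤ τ)
    (h1 : τ ≤ 1) (hY : ∀ k : ℕ, 0 ≤ 1 - τ + 2 * τ * (2 * bI α β k - 1))
    (hX : ∀ n : ℕ, n ≠ 0 → 0 ≤ 1 - τ + 2 * τ * (2 * jacB α β (n + γ + 1 / 2) - 1)) :
    IsQBDTransitionMatrix (P α β γ τ) := by
  have hτ : 0 ≤ 1 - τ := sub_nonneg.2 h1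
  have hP : IsStochastic (P α β γ τ) := by
    refine ⟨?_, rowSumsOne_P α β γ τ⟩
    rintro ⟨n, k, hk⟩ ⟨m, j⟩
    replace hk := Nat.lt_succ_iff.1 hk
    change 0 ≤ (1 - τ) * J1 α β γ _ _ + τ * J2 α β γ _ _
    unfold J1 J2 blockTridiag
    dsimp only
    split_ifs
    · apply mul_tridiag_add_mul_tridiag_nonneg
      · simpa using mul_nonneg h0 (h.a1_nonneg hk)
      · rw [a2_eq_mul]
        have := mul_nonneg (hY k) (h.a_nonneg hk)
        linarith
      · simpa using mul_nonneg h0 h.a3_nonneg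
    · apply mul_tridiag_add_mul_tridiag_nonneg
      -- At level `0` there is no change of phase within the level, so the weight at `γ + 1/2`,
      -- possibly singular, is never needed.
      · rcases eq_or_ne n 0 with rfl | hn
        · obtain rfl : k = 0 := by omega
          simp [d, b1, cI_zero]
        · rw [b1_eq_mul]
          have := mul_nonneg (hX n hn) (h.d_nonneg hk)
          linarith
      · exact add_nonneg (mul_nonneg hτ (h.b_nonneg hk)) (mul_nonneg h0 (h.b2_nonneg hk))
      · rcases eq_or_ne n 0 with rfl | hn
        · obtain rfl : k = 0 := by omega
          simp [e, b3, del]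
        · rw [b3_eq_mul]
          have := mul_nonneg (hX n hn) (h.e_nonneg hk)
          linarith
    · apply mul_tridiag_add_mul_tridiag_nonneg
      · simpa using mul_nonneg h0 (h.c1_nonneg hk)
      · rw [c2_eq_mul]
        have := mul_nonneg (hY k) (h.c_nonneg hk)
        linarith
      · simpa using mul_nonneg h0 (h.c3_nonneg hk)
    · simp
  exact ⟨hP, isBlockTridiagonal_P α β γ τ, exists_isMarkovChain hP⟩

theorem weight_nonneg {α β τ x : ℝ} (hx : 0 < 2 * x + α + β)
    (h : 2 * (α ^ 2 - β ^ 2) * τ ≤ (1 - τ) * ((2 * x + α + β) * (2 * x + α + β + 2))) :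
    0 ≤ 1 - τ + 2 * τ * (2 * jacB α β x - 1) := by
  rw [two_mul_jacB_sub_one α β x (by linarith) (by linarith) (by linarith)]
  have hz : 0 < (2 * x + α + β) * (2 * x + α + β + 2) := by positivity
  rw [show 1 - τ + 2 * τ * ((β ^ 2 - α ^ 2) / ((2 * x + α + β) * (2 * x + α + β + 2))) =
    ((1 - τ) * ((2 * x + α + β) * (2 * x + α + β + 2)) - 2 * (α ^ 2 - β ^ 2) * τ) /
      ((2 * x + α + β) * (2 * x + α + β + 2)) by field_simp; ring]
  exact div_nonneg (by linarith) hz.le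

/-- A sufficient condition in terms of the sums `w = 2 x + α + β` that occur. -/
theorem Admissible.isQBDTransitionMatrix_P_of_le {α β γ τ : ℝ} (h : Admissible α β γ)
    (h0 : 0 ≤ τ) (h1 : τ ≤ 1) (hzero : 2 * (α - β) * τ ≤ (1 - τ) * (α + β + 2))
    (hY : ∀ w, α + β + 2 ≤ w → 2 * (α ^ 2 - β ^ 2) * τ ≤ (1 - τ) * (w * (w + 2)))
    (hX : ∀ w, α + β + 2 * γ + 3 ≤ w → 2 * (α ^ 2 - β ^ 2) * τ ≤ (1 - τ) * (w * (w + 2))) :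
    IsQBDTransitionMatrix (P α β γ τ) := by
  obtain ⟨i1, i2, i3, i4, i5⟩ := id h
  refine h.isQBDTransitionMatrix_P h0 h1 ?_ ?_
  · intro k
    rcases eq_or_ne k 0 with rfl | hk
    -- For `k = 0` the cancelled form of `b_0` gives a condition linear in the parameters, separate
    -- from the family indexed by `w`.
    · have hs : 0 < α + β + 2 := by linarith
      rw [bI, if_pos rfl, show 1 - τ + 2 * τ * (2 * ((β + 1) / (α + β + 2)) - 1) =
        ((1 - τ) * (α + β + 2) - 2 * (α - β) * τ) / (α + β + 2) by field_simp; ring]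
      exact div_nonneg (by linarith) hs.le
    · have := one_le_cast hk
      rw [bI, if_neg hk]
      exact weight_nonneg (by linarith) (hY _ (by linarith))
  · intro n hn
    have := one_le_cast hn
    -- Here `w = 2n + 2γ + 1 + α + β`, smallest at `n = 1`.
    exact weight_nonneg (by linarith) (hX _ (by linarith))

/-- `Cst α β y` is the value of `τ` with equality at `w = α + β + 2y + 1`. Since `w(w + 2)`
increases for positive `w`, this first value is decisive: `y = 1/2` belongs to `k = 1` and `y = γ +
1` to `n = 1`. -/
theorem le_of_le_Cst {α β τ y w : ℝ} (hδ : 0 < α ^ 2 - β ^ 2) (hy : 0 < α + β + 2 * y + 1)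
    (hτ : τ ≤ Cst α β y) (hw : α + β + 2 * y + 1 ≤ w) :
    τ ≤ 1 ∧ 2 * (α ^ 2 - β ^ 2) * τ ≤ (1 - τ) * (w * (w + 2)) := by
  have hz : 0 < (α + β + 2 * y + 1) * (α + β + 2 * y + 3) := mul_pos hy (by linarith)
  unfold Cst at hτ
  rw [le_div_iff₀ (by linarith)] at hτ
  have h1 : τ ≤ 1 := by
    by_contra! hlt
    nlinarith
  refine ⟨h1, ?_⟩
  have h2 : (α + β + 2 * y + 1) * (α + β + 2 * y + 3) ≤ w * (w + 2) :=
    mul_le_mul hw (by linarith) (by linarith) (by linarith)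
  have := mul_le_mul_of_nonneg_left h2 (sub_nonneg.2 h1)
  linarith

/-- Here `α² < β²` and `α < β`, so every weight is nonnegative for all `τ` in `[0, 1]`. -/
theorem Admissible.isQBDTransitionMatrix_P_of_neg_lt {α β γ τ : ℝ} (hA : Admissible α β γ)
    (h1 : α < β) (h2 : -α < β) (h0 : 0 ≤ τ) (hτ : τ ≤ 1) :
    IsQBDTransitionMatrix (P α β γ τ) := by
  have hγ := hA.hγ
  have hδ : α ^ 2 - β ^ 2 ≤ 0 := by nlinarith
  have hδτ : 2 * (α ^ 2 - β ^ 2) * τ ≤ 0 := by nlinarith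
  have hτ' : 0 ≤ 1 - τ := sub_nonneg.2 hτ
  refine hA.isQBDTransitionMatrix_P_of_le h0 hτ ?_ ?_ ?_
  · have : 0 ≤ (1 - τ) * (α + β + 2) := mul_nonneg hτ' (by linarith)
    have : 0 ≤ (β - α) * τ := mul_nonneg (by linarith) h0
    linarith
  all_goals
    intro w hw
    exact hδτ.trans (mul_nonneg hτ' (mul_nonneg (by linarith) (by linarith)))

/-- The bound on `τ` is the condition at `k = 0`. Multiplied by `w ≥ α + β`, `w > 0`, it implies all
the others. -/
theorem Admissible.isQBDTransitionMatrix_P_of_gt {α β γ τ : ℝ} (hA : Admissible α β γ)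
    (h1 : β < α) (h0 : 0 ≤ τ) (hτ : τ ≤ CstNegHalf α β) :
    IsQBDTransitionMatrix (P α β γ τ) := by
  obtain ⟨hα, hβ, hγ, hαγ, hβγ⟩ := id hA
  unfold CstNegHalf at hτ
  rw [le_div_iff₀ (by linarith)] at hτ
  have hτ1 : τ ≤ 1 := by
    by_contra! hlt
    nlinarith
  have hτ' : 0 ≤ 1 - τ := sub_nonneg.2 hτ1
  have hzero : 2 * (α - β) * τ ≤ (1 - τ) * (α + β + 2) := by linarith
  have key : ∀ w, 0 < w → α + β ≤ w →
      2 * (α ^ 2 - β ^ 2) * τ ≤ (1 - τ) * (w * (w + 2)) := by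
    intro w hw hle
    rw [show 2 * (α ^ 2 - β ^ 2) * τ = 2 * (α - β) * τ * (α + β) by ring]
    have hnn : 0 ≤ 2 * (α - β) * τ := mul_nonneg (by linarith) h0
    calc 2 * (α - β) * τ * (α + β) ≤ 2 * (α - β) * τ * w := mul_le_mul_of_nonneg_left hle hnn
      _ ≤ (1 - τ) * (α + β + 2) * w := mul_le_mul_of_nonneg_right hzero hw.le
      _ = (1 - τ) * (w * (α + β + 2)) := by ring
      _ ≤ (1 - τ) * (w * (w + 2)) := by gcongr
  exact hA.isQBDTransitionMatrix_P_of_le h0 hτ1 hzero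
    (fun w hw => key w (by linarith) (by linarith))
    (fun w hw => key w (by linarith) (by linarith))

/-- Now `α² > β²`, so the first weights `k = 1` and `n = 1` bind, whereas `k = 0` is harmless
because `α < β`. -/
theorem Admissible.isQBDTransitionMatrix_P_of_lt_neg {α β γ τ : ℝ} (hA : Admissible α β γ)
    (h1 : α < β) (h2 : β < -α) (h0 : 0 ≤ τ)
    (hτ : τ ≤ min (Cst α β (1 / 2)) (Cst α β (γ + 1))) :
    IsQBDTransitionMatrix (P α β γ τ) := by
  obtain ⟨hα, hβ, hγ, hαγ, hβγ⟩ := id hA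
  have hδ : 0 < α ^ 2 - β ^ 2 := by nlinarith
  have hY : ∀ w, α + β + 2 * (1 / 2) + 1 ≤ w → _ := fun w =>
    le_of_le_Cst hδ (by linarith) (hτ.trans (min_le_left _ _))
  have hX : ∀ w, α + β + 2 * (γ + 1) + 1 ≤ w → _ := fun w =>
    le_of_le_Cst hδ (by linarith) (hτ.trans (min_le_right _ _))
  have hτ1 : τ ≤ 1 := (hY _ le_rfl).1
  refine hA.isQBDTransitionMatrix_P_of_le h0 hτ1 ?_
    (fun w hw => (hY w (by linarith)).2) (fun w hw => (hX w (by linarith)).2)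
  have : 0 ≤ (1 - τ) * (α + β + 2) := mul_nonneg (sub_nonneg.2 hτ1) (by linarith)
  have : 0 ≤ (β - α) * τ := mul_nonneg (by linarith) h0
  linarith

end JacobiKoornwinder

theorem mainTheorem2 (α β γ : ℝ) (hα : -1 < α) (hβ : -1 < β) (hγ : -1 < γ) :
    (0 < α + γ + 3 / 2 → 0 < β + γ + 3 / 2 →
      JacobiKoornwinder.RowSumsOne (JacobiKoornwinder.J1 α β γ) ∧
      JacobiKoornwinder.RowSumsOne (JacobiKoornwinder.J2 α β γ)) ∧
    (α < β → -α < β → (α < -1 / 2 → 0 < α + γ + 3 / 2) →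
      ∀ τ : ℝ, 0 ≤ τ → τ ≤ 1 →
        JacobiKoornwinder.IsQBDTransitionMatrix (JacobiKoornwinder.P α β γ τ)) ∧
    (β < α → (β < -1 / 2 → 0 < β + γ + 3 / 2) →
      ∀ τ : ℝ, 0 ≤ τ → τ ≤ JacobiKoornwinder.CstNegHalf α β →
        JacobiKoornwinder.IsQBDTransitionMatrix (JacobiKoornwinder.P α β γ τ)) ∧
    (α < β → β < -α → (α < -1 / 2 → 0 < α + γ + 3 / 2) →
      ∀ τ : ℝ, 0 ≤ τ →
        τ ≤ min (JacobiKoornwinder.Cst α β (1 / 2)) (JacobiKoornwinder.Cst α β (γ + 1)) →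
        JacobiKoornwinder.IsQBDTransitionMatrix (JacobiKoornwinder.P α β γ τ)) := by
  -- For `x ≥ -1/2` the inequality follows from `γ > -1`. It is applied to the smaller of `α` and
  -- `β`, and the larger one inherits it.
  have adm : ∀ x : ℝ, (x < -1 / 2 → 0 < x + γ + 3 / 2) → 0 < x + γ + 3 / 2 := by
    intro x hx
    rcases lt_or_ge x (-1 / 2) with h | h
    · exact hx h
    · linarith
  refine ⟨fun _ _ => ⟨JacobiKoornwinder.rowSumsOne_J1 α β γ,
    JacobiKoornwinder.rowSumsOne_J2 α β γ⟩, ?_, ?_, ?_⟩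
  · intro h1 h2 h3 τ h0 hτ
    have hA : JacobiKoornwinder.Admissible α β γ :=
      ⟨hα, hβ, hγ, adm α h3, by linarith [adm α h3]⟩
    exact hA.isQBDTransitionMatrix_P_of_neg_lt h1 h2 h0 hτ
  · intro h1 h2 τ h0 hτ
    have hA : JacobiKoornwinder.Admissible α β γ :=
      ⟨hα, hβ, hγ, by linarith [adm β h2], adm β h2⟩
    exact hA.isQBDTransitionMatrix_P_of_gt h1 h0 hτ
  · intro h1 h2 h3 τ h0 hτ
    have hA : JacobiKoornwinder.Admissible α β γ :=
      ⟨hα, hβ, hγ, adm α h3, by linarith [adm α h3]⟩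
    exact hA.isQBDTransitionMatrix_P_of_lt_neg h1 h2 h0 hτ
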